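/- Let $V$ be a countable set with the discrete topology, and let $r(x,y)\ge 0$, $x\ne y$ in $V$, be jump rates (with $r(x,x):=0$) such that $r(x):=\sum_y r(x,y)<+\infty$ for every $x\in V$. Assume that the continuous time Markov chain with these jump rates almost surely does not explode from any starting state, is irreducible (from each $x$ and at each time $t>0$ every state $y$ is occupied with strictly positive probability), and has a unique invariant probability measure, i.e. a unique probability $\pi$ on $V$ with $\sum_y \pi(x)r(x,y)=\sum_y\pi(y)r(y,x)$ for all $x$. Let $\mathbb P_x$ be the law of the chain started at $x$, on the space $D(\mathbb R_+;V)$ of càdlàg paths $X=(X_t)_{t\ge0}$. Let $\mathcal P(V)$ be the space of probability measures on $V$ with the weak topology. For $T>0$ let $\mu_T:=\frac1T\int_0^T\delta_{X_t}\,dt\in\mathcal P(V)$ be the empirical measure and let $$Q_T(y,z):=\frac1T\sum_{0\le t\le T}\mathbf 1\{X_{t^-}=y,\;X_t=z\},\qquad y\neq z,$$ with $X_{0^-}:=X_0$, be the empirical flow; put $\|Q_T\|:=\sum_{y\ne z}Q_T(y,z)$. Let $E:=\{(y,z):y\ne z,\ r(y,z)>0\}$, and let $L^1_+(E)$ be the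 set of nonnegative elements of $L^1(E)$, viewed inside $[0,+\infty]^{\{(y,z):y\ne z\}}$ by extending flows by $0$ off $E$. It carries the topology induced by the bounded weak* topology of $L^1(E)=C_0(E)^*$, in which a set $A$ is open iff for every $\ell>0$ the set $A\cap\{\|Q\|\le\ell\}$ is weak*-open in the ball $\{\|Q\|\le \ell\}$. Assume the following compactness condition: there are functions $u_n\colon V\to(0,+\infty)$, $n\in\mathbb N$, such that 1. $\sum_{y}r(x,y)u_n(y)<+\infty$ for all $x\in V$, $n\in\mathbb N$; write $Lu_n(x):=\sum_y r(x,y)[u_n(y)-u_n(x)]$; 2. there is $c>0$ with $u_n(x)\ge c$ for all $x\in V$, $n\in\mathbb N$; 3. for each $x\in V$ there is a constant $C_x$ with $u_n(x)\le C_x$ for all $n\in\mathbb N$; 4. $-Lu_n/u_n$ converges pointwise on $V$, as $n\to\infty$, to some $v\colon V\to\mathbb R$; 5. for each $a\in\mathbb R$ the set $\{x\in V: v(x)\le a\}$ is finite; 6. there are constants $\sigma>0$ and $C\ge0$ with $v(x)\ge\sigma r(x)-C$ for all $x\in V$. Then for each $x\in V$ there exist a sequence $(\mathcal K_\ell)_{\ell\in\mathbb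 N}$ of compact subsets of $\mathcal P(V)$ and a strictly increasing real sequence $A_\ell\uparrow+\infty$ such that for every $\ell\in\mathbb N$ $$\varlimsup_{T\to+\infty}\frac1T\log\mathbb P_x\big(\mu_T\notin\mathcal K_\ell\big)\le-\ell,\qquad \varlimsup_{T\to+\infty}\frac1T\log\mathbb P_x\big(\|Q_T\|>A_\ell\big)\le-\ell .$$ In particular, under $\mathbb P_x$, the empirical measure is exponentially tight in $\mathcal P(V)$ and the empirical flow is exponentially tight in $L^1_+(E)$: for every $M\in\mathbb R$ there are a compact $\mathcal K\subset\mathcal P(V)$ and a compact $\mathcal H\subset L^1_+(E)$ with $$\varlimsup_{T\to+\infty}\frac1T\log\mathbb P_x(\mu_T\notin\mathcal K)\le-M,\qquad \varlimsup_{T\to+\infty}\frac1T\log\mathbb P_x(Q_T\notin\mathcal H)\le-M .$$ -/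

import Mathlib

open MeasureTheory ProbabilityTheory Filter Topology Set
open scoped NNReal ENNReal ZeroAtInfty

noncomputable section

namespace JumpChain

/-! ### Jump rates -/

/-- Jump rates `r(x,y)`, `x ≠ y`, on `V` with finite exit rates; as usual
`r(x,x) = 0`. -/
structure Rates (V : Type*) where
  /-- the rate `r(x,y)` -/
  rate : V → V → ℝ≥0
  rate_self : ∀ x, rate x x = 0
  summable_rate : ∀ x, Summable (rate x)

/-- The exit rate `r(x) = ∑_y r(x,y)`. -/
def Rates.exit {V : Type*} (r : Rates V) (x : V) : ℝ≥0 := ∑' y, r.rate x y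

lemma Rates.tsum_coe {V : Type*} (r : Rates V) (x : V) :
    ∑' y, (r.rate x y : ℝ≥0∞) = (r.exit x : ℝ≥0∞) :=
  (ENNReal.coe_tsum (r.summable_rate x)).symm

/-- The jump matrix `r(x,y) / r(x)`; a state with `r(x) = 0` is absorbing. -/
def Rates.jump {V : Type*} (r : Rates V) (x : V) : PMF V :=
  if h : r.exit x = 0 then PMF.pure x
  else PMF.normalize (fun y => (r.rate x y : ℝ≥0∞))
    (by rw [r.tsum_coe]; exact_mod_cast h) (by rw [r.tsum_coe]; exact ENNReal.coe_ne_top)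

/-- `L f (x) = ∑_y r(x,y) (f(y) - f(x))`, for `f` with `∑_y r(x,y) |f(y)| < ∞`. -/
def Rates.gen {V : Type*} (r : Rates V) (f : V → ℝ) (x : V) : ℝ :=
  ∑' y, (r.rate x y : ℝ) * (f y - f x)

/-! ### Path space -/

/-- The space `D(ℝ₊; V)` of right continuous paths with left limits. -/
structure PathSpace (V : Type*) [TopologicalSpace V] where
  /-- the state `X_t` -/
  toFun : ℝ≥0 → V
  cadlag : ∀ t, ContinuousWithinAt toFun (Ici t) t ∧ ∃ y, Tendsto toFun (𝓝[<] t) (𝓝 y)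

instance {V : Type*} [TopologicalSpace V] : CoeFun (PathSpace V) (fun _ => ℝ≥0 → V) :=
  ⟨PathSpace.toFun⟩

/-- The σ-algebra generated by the canonical coordinates `X ↦ X_t`, which is the Borel σ-algebra
of the Skorohod topology. -/
instance {V : Type*} [TopologicalSpace V] [MeasurableSpace V] : MeasurableSpace (PathSpace V) :=
  MeasurableSpace.comap PathSpace.toFun inferInstance

/-! ### The Markov chain built from its jump chain and its holding times -/

/-- A sample `ω n = (Y_n, τ_n)`: the `n`-th visited state and a unit exponential variable, which
divided by `r(Y_n)` is the time spent there. -/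
abbrev Sample (V : Type*) := ℕ → V × ℝ

section Construction

variable {V : Type*}

/-- From state `x`, choose the next state by the jump matrix and an independent unit exponential
variable. -/
def Rates.step [Countable V] [MeasurableSpace V] [MeasurableSingletonClass V] (r : Rates V) :
    Kernel V (V × ℝ) :=
  Kernel.ofFunOfCountable fun x => (r.jump x).toMeasure.prod (expMeasure 1)

instance : IsProbabilityMeasure (expMeasure 1) := isProbabilityMeasure_expMeasure one_pos

instance [Countable V] [MeasurableSpace V] [MeasurableSingletonClass V] (r : Rates V) :
    IsMarkovKernel r.step :=
  ⟨fun x => by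
    change IsProbabilityMeasure ((r.jump x).toMeasure.prod (expMeasure 1)); infer_instance⟩

/-- The law of `((Y_n, τ_n))_{n ≥ 0}`: a Markov chain `Y` with the jump matrix as transition matrix
and `Y_0 = x`, and an independent sequence `τ` of independent unit exponential variables. -/
def Rates.sampleLaw [Countable V] [MeasurableSpace V] [MeasurableSingletonClass V] (r : Rates V)
    (x : V) : Measure (Sample V) :=
  Kernel.trajMeasure (X := fun _ => V × ℝ) ((Measure.dirac x).prod (expMeasure 1)) fun n =>
    r.step.comap (fun h => (h ⟨n, Finset.mem_Iic.2 le_rfl⟩).1) (by fun_prop)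

/-- The time of the `n`-th jump, `∑_{i < n} τ_i / r(Y_i)`; an absorbing state is never left. -/
def Rates.jumpTime (r : Rates V) (ω : Sample V) (n : ℕ) : ℝ≥0∞ :=
  ∑ i ∈ Finset.range n, ENNReal.ofReal (ω i).2 / (r.exit (ω i).1 : ℝ≥0∞)

/-- The sample does not explode: the jump times increase to infinity. -/
def Rates.NoExplosion (r : Rates V) (ω : Sample V) : Prop :=
  ∀ t : ℝ≥0, ∃ n, (t : ℝ≥0∞) < r.jumpTime ω (n + 1)

open Classical in
/-- The state at time `t`: it is `Y_n` for `J_n ≤ t < J_{n+1}`, where `J` are the jump times. -/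
def Rates.stateAt (r : Rates V) (ω : Sample V) (h : r.NoExplosion ω) (t : ℝ≥0) : V :=
  (ω (Nat.find (h t))).1

lemma Rates.jumpTime_mono (r : Rates V) (ω : Sample V) : Monotone (r.jumpTime ω) := fun _ _ h =>
  Finset.sum_le_sum_of_subset (Finset.range_mono h)

lemma Rates.stateAt_eq (r : Rates V) (ω : Sample V) (h : r.NoExplosion ω) {t : ℝ≥0} {n : ℕ}
    (h₁ : r.jumpTime ω n ≤ t) (h₂ : (t : ℝ≥0∞) < r.jumpTime ω (n + 1)) :
    r.stateAt ω h t = (ω n).1 := by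
  classical
  have : Nat.find (h t) = n := by
    rw [Nat.find_eq_iff]
    exact ⟨h₂, fun m hm => not_lt.2 ((r.jumpTime_mono ω hm).trans h₁)⟩
  unfold Rates.stateAt
  convert rfl using 3
  exact this.symm

lemma Rates.jumpTime_le_of_forall (r : Rates V) (ω : Sample V) {t : ℝ≥0∞} (n : ℕ)
    (h : ∀ m < n, r.jumpTime ω (m + 1) ≤ t) : r.jumpTime ω n ≤ t := by
  cases n with
  | zero => simp [Rates.jumpTime]
  | succ k => exact h k (Nat.lt_succ_self k)

lemma Rates.exists_jumpTime (r : Rates V) (ω : Sample V) (h : r.NoExplosion ω) (t : ℝ≥0) :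
    ∃ n, r.jumpTime ω n ≤ t ∧ (t : ℝ≥0∞) < r.jumpTime ω (n + 1) := by
  classical
  exact ⟨Nat.find (h t), r.jumpTime_le_of_forall ω _ fun m hm => not_lt.1 (Nat.find_min (h t) hm),
    Nat.find_spec (h t)⟩

lemma Rates.stateAt_cadlag [TopologicalSpace V] (r : Rates V) (ω : Sample V)
    (h : r.NoExplosion ω) (t : ℝ≥0) :
    ContinuousWithinAt (r.stateAt ω h) (Ici t) t ∧
      ∃ y, Tendsto (r.stateAt ω h) (𝓝[<] t) (𝓝 y) := by
  classical
  constructor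
  · obtain ⟨n, h₁, h₂⟩ := r.exists_jumpTime ω h t
    have hev : ∀ᶠ s in 𝓝[≥] t, r.stateAt ω h s = r.stateAt ω h t := by
      have : ∀ᶠ s : ℝ≥0 in 𝓝 t, (s : ℝ≥0∞) < r.jumpTime ω (n + 1) :=
        ENNReal.continuous_coe.continuousAt.eventually_lt continuousAt_const h₂
      filter_upwards [nhdsWithin_le_nhds this, self_mem_nhdsWithin] with s hs hts
      rw [r.stateAt_eq ω h h₁ h₂]
      exact r.stateAt_eq ω h (h₁.trans (by exact_mod_cast hts)) hs
    exact (tendsto_const_nhds (x := r.stateAt ω h t)).congr' (hev.mono fun s hs => hs.symm)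
  · have hex : ∃ n, (t : ℝ≥0∞) ≤ r.jumpTime ω (n + 1) := (h t).imp fun n hn => hn.le
    have hn := Nat.find_spec hex
    have hmin : ∀ m < Nat.find hex, r.jumpTime ω (m + 1) < t := fun m hm =>
      not_le.1 (Nat.find_min hex hm)
    set n := Nat.find hex
    refine ⟨(ω n).1, (tendsto_const_nhds (x := (ω n).1)).congr' ?_⟩
    rcases eq_or_ne t 0 with rfl | ht
    · have : (𝓝[<] (0 : ℝ≥0)) = ⊥ := by
        have : Iio (0 : ℝ≥0) = ∅ := by ext s; simp
        rw [this, nhdsWithin_empty]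
      rw [this]
      exact Filter.eventually_bot
    have hlt : r.jumpTime ω n < t := by
      rcases Nat.eq_zero_or_pos n with h0 | h0
      · rw [h0]; simpa [Rates.jumpTime] using pos_iff_ne_zero.2 ht
      · obtain ⟨k, hk⟩ := Nat.exists_eq_succ_of_ne_zero h0.ne'
        rw [hk]; exact hmin k (by omega)
    have : ∀ᶠ s : ℝ≥0 in 𝓝 t, r.jumpTime ω n < (s : ℝ≥0∞) :=
      continuousAt_const.eventually_lt ENNReal.continuous_coe.continuousAt hlt
    filter_upwards [nhdsWithin_le_nhds this, self_mem_nhdsWithin] with s hs hts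
    exact (r.stateAt_eq ω h hs.le (lt_of_lt_of_le (by exact_mod_cast hts) hn)).symm

open Classical in
/-- The path of the chain. Exploding samples, which form a null set when the chain is non-explosive, are sent to a
constant path. -/
def Rates.path [TopologicalSpace V] (r : Rates V) (ω : Sample V) : PathSpace V :=
  if h : r.NoExplosion ω then ⟨r.stateAt ω h, r.stateAt_cadlag ω h⟩
  else ⟨fun _ => (ω 0).1, fun _ => ⟨continuousWithinAt_const, _, tendsto_const_nhds⟩⟩

lemma Rates.measurable_jumpTime [Countable V] [MeasurableSpace V] [MeasurableSingletonClass V]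
    (r : Rates V) (n : ℕ) : Measurable fun ω : Sample V => r.jumpTime ω n := by
  refine Finset.measurable_sum _ fun i _ => Measurable.div (by fun_prop) ?_
  exact (measurable_of_countable fun x => (r.exit x : ℝ≥0∞)).comp
    (measurable_fst.comp (measurable_pi_apply i))

lemma Rates.measurableSet_noExplosion [Countable V] [MeasurableSpace V]
    [MeasurableSingletonClass V] (r : Rates V) : MeasurableSet {ω | r.NoExplosion ω} := by
  have : {ω | r.NoExplosion ω} = ⋂ N : ℕ, ⋃ n, {ω | (N : ℝ≥0∞) < r.jumpTime ω (n + 1)} := by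
    ext ω
    simp only [mem_ofPred_eq, mem_iInter, mem_iUnion]
    refine ⟨fun h N => by simpa using h N, fun h t => ?_⟩
    obtain ⟨N, hN⟩ := exists_nat_ge t
    obtain ⟨n, hn⟩ := h N
    exact ⟨n, lt_of_le_of_lt (by exact_mod_cast hN) hn⟩
  rw [this]
  exact .iInter fun N => .iUnion fun n => measurableSet_lt measurable_const (r.measurable_jumpTime _)

lemma Rates.measurable_path [Countable V] [TopologicalSpace V] [MeasurableSpace V]
    [MeasurableSingletonClass V] (r : Rates V) : Measurable (r.path : Sample V → PathSpace V) := by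
  refine measurable_comap_iff.2 (measurable_pi_lambda _ fun t => ?_)
  change Measurable fun ω => r.path ω t
  have hc : ∀ n : ℕ, Measurable fun ω : Sample V => (ω n).1 := fun n => by fun_prop
  refine measurable_to_countable' fun y => ?_
  have : (fun ω => r.path ω t) ⁻¹' {y} =
      ({ω | r.NoExplosion ω} ∩ ⋃ n, ({ω | r.jumpTime ω n ≤ t} ∩
        {ω | (t : ℝ≥0∞) < r.jumpTime ω (n + 1)}) ∩ (fun ω : Sample V => (ω n).1) ⁻¹' {y}) ∪
      ({ω | r.NoExplosion ω}ᶜ ∩ (fun ω : Sample V => (ω 0).1) ⁻¹' {y}) := by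
    ext ω
    by_cases h : r.NoExplosion ω
    · have hp : r.path ω t = r.stateAt ω h t := by simp [Rates.path, h]
      simp only [mem_preimage, mem_singleton_iff, mem_union, mem_inter_iff, mem_ofPred_eq, h,
        true_and, mem_iUnion, mem_compl_iff, not_true_eq_false, false_and, or_false, hp]
      constructor
      · intro hy
        obtain ⟨n, h₁, h₂⟩ := r.exists_jumpTime ω h t
        exact ⟨n, ⟨h₁, h₂⟩, by rw [← r.stateAt_eq ω h h₁ h₂]; exact hy⟩
      · rintro ⟨n, ⟨h₁, h₂⟩, hy⟩
        rw [r.stateAt_eq ω h h₁ h₂]; exact hy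
    · simp [Rates.path, h]
  rw [this]
  refine .union (.inter r.measurableSet_noExplosion (.iUnion fun n => .inter (.inter ?_ ?_) ?_))
    (.inter r.measurableSet_noExplosion.compl (hc 0 (measurableSet_singleton y)))
  · exact measurableSet_le (r.measurable_jumpTime n) measurable_const
  · exact measurableSet_lt measurable_const (r.measurable_jumpTime _)
  · exact hc n (measurableSet_singleton y)

/-- The law `ℙ_x` on `D(ℝ₊; V)` of the chain started from `x`. -/
def Rates.law [Countable V] [TopologicalSpace V] [MeasurableSpace V]
    [MeasurableSingletonClass V] (r : Rates V) (x : V) : Measure (PathSpace V) :=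
  (r.sampleLaw x).map r.path

instance [Countable V] [TopologicalSpace V] [MeasurableSpace V]
    [MeasurableSingletonClass V] (r : Rates V) (x : V) : IsProbabilityMeasure (r.law x) := by
  have : IsProbabilityMeasure (r.sampleLaw x) := by unfold Rates.sampleLaw; infer_instance
  exact Measure.isProbabilityMeasure_map r.measurable_path.aemeasurable

end Construction

/-! ### Assumptions on the chain -/

section Assumptions

variable {V : Type*} [Countable V] [TopologicalSpace V] [MeasurableSpace V]
  [MeasurableSingletonClass V]

/-- From every starting state there is almost surely no explosion. -/
def Rates.NonExplosive (r : Rates V) : Prop := ∀ x, ∀ᵐ ω ∂r.sampleLaw x, r.NoExplosion ω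

/-- Every state is reached at every positive time with positive probability. -/
def Rates.Irreducible (r : Rates V) : Prop :=
  ∀ x y : V, ∀ t : ℝ≥0, 0 < t → 0 < r.law x {X | X t = y}

/-- `∑_y π(x) r(x,y) = ∑_y π(y) r(y,x)` for all `x`. -/
def Rates.Invariant (r : Rates V) (π : ProbabilityMeasure V) : Prop :=
  ∀ x, ∑' y, (π : Measure V) {x} * (r.rate x y : ℝ≥0∞) =
    ∑' y, (π : Measure V) {y} * (r.rate y x : ℝ≥0∞)

/-- The compactness condition: there are `u_n : V → (0,∞)`, bounded below uniformly and bounded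
above uniformly in `n` at each point, with `-L u_n / u_n → v` pointwise, where `v` has finite
sublevel sets and `v ≥ σ r - C` for some `σ > 0` and `C ≥ 0`. -/
def Rates.CompactnessCondition {V : Type*} (r : Rates V) : Prop :=
  ∃ u : ℕ → V → ℝ, (∀ n x, 0 < u n x) ∧
    (∀ n x, Summable fun y => (r.rate x y : ℝ) * u n y) ∧
    (∃ c : ℝ, 0 < c ∧ ∀ n x, c ≤ u n x) ∧
    (∀ x, ∃ Cx : ℝ, ∀ n, u n x ≤ Cx) ∧
    ∃ v : V → ℝ,
      (∀ x, Tendsto (fun n => -r.gen (u n) x / u n x) atTop (𝓝 (v x))) ∧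
      (∀ a : ℝ, {x | v x ≤ a}.Finite) ∧
      ∃ σ C : ℝ, 0 < σ ∧ 0 ≤ C ∧ ∀ x, σ * (r.exit x : ℝ) - C ≤ v x

end Assumptions

/-! ### Empirical measure -/

section EmpiricalMeasure

variable {V : Type*} [Countable V] [TopologicalSpace V] [DiscreteTopology V] [MeasurableSpace V]

lemma PathSpace.measurable (X : PathSpace V) : Measurable (X : ℝ≥0 → V) := by
  refine measurable_to_countable' fun y => MeasurableSet.of_mem_nhdsGT fun t ht => ?_
  have h := (X.cadlag t).1.preimage_mem_nhdsWithin (t := {y}) (by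
    rw [mem_preimage, mem_singleton_iff] at ht
    rw [nhds_discrete, ht]; exact mem_pure.2 rfl)
  exact nhdsWithin_mono _ Ioi_subset_Ici_self h

open Classical in
/-- The empirical measure `μ_T = T⁻¹ ∫_0^T δ_{X_t} dt`, for `T > 0`. -/
def empMeasure (T : ℝ≥0) (X : PathSpace V) : ProbabilityMeasure V :=
  if hT : 0 < T then
    ⟨(T : ℝ≥0∞)⁻¹ • (volume.restrict (Icc (0 : ℝ) T)).map (fun t => X t.toNNReal), ⟨by
      have hX : Measurable fun t : ℝ => X t.toNNReal := X.measurable.comp measurable_real_toNNReal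
      rw [Measure.smul_apply, Measure.map_apply hX MeasurableSet.univ]
      simp only [preimage_univ, Measure.restrict_apply MeasurableSet.univ, univ_inter,
        Real.volume_Icc, sub_zero, ENNReal.ofReal_coe_nnreal, smul_eq_mul]
      exact ENNReal.inv_mul_cancel (by exact_mod_cast hT.ne') ENNReal.coe_ne_top⟩⟩
  else ⟨Measure.dirac (X 0), inferInstance⟩

end EmpiricalMeasure

/-! ### Empirical flow -/

/-- The set `B` of ordered pairs `(y,z)` with `y ≠ z`. -/
abbrev Bond (V : Type*) := {p : V × V // p.1 ≠ p.2}

/-- The set `E ⊆ B` of ordered edges with positive jump rate. -/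
def Rates.edges {V : Type*} (r : Rates V) : Set (Bond V) := {e | 0 < r.rate e.1.1 e.1.2}

open Classical in
/-- The empirical flow `Q_T(y,z) = T⁻¹ ∑_{0 ≤ t ≤ T} δ_y(X_{t-}) δ_z(X_t)` (with `X_{0-} = X_0`),
as an element of `[0,∞]^B`, for `T > 0`. -/
def empFlow {V : Type*} [TopologicalSpace V] (T : ℝ≥0) (X : PathSpace V) : Bond V → ℝ≥0∞ :=
  fun e => (T : ℝ≥0∞)⁻¹ * ∑' t : Icc (0 : ℝ≥0) T,
    if Function.leftLim (X : ℝ≥0 → V) t = e.1.1 ∧ X t = e.1.2 then 1 else 0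

/-- The `L¹` norm of a flow in `[0,∞]^B`. -/
def flowNorm {V : Type*} (Q : Bond V → ℝ≥0∞) : ℝ≥0∞ := ∑' e, Q e

section FlowSpace

variable {V : Type*}

/-- `L¹(E)`. -/
abbrev Rates.L1 (r : Rates V) : Type _ := lp (fun _ : r.edges => ℝ) 1

/-- The weak* topology of `L¹(E)`, as the dual of the space `C₀(E)` of functions on the discrete
set `E` that vanish at infinity. -/
@[reducible]
def Rates.weakStar [TopologicalSpace V] (r : Rates V) : TopologicalSpace r.L1 :=
  ⨅ f : C₀(r.edges, ℝ),
    TopologicalSpace.induced (fun Q : r.L1 => ∑' e, Q e * f e) inferInstance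

/-- The bounded weak* topology of `L¹(E)`: a set `A` is open iff, for every `ℓ > 0`, its trace
`A ∩ B_ℓ` is open in the closed ball `B_ℓ = {‖Q‖ ≤ ℓ}` with the weak* topology. -/
@[reducible]
def Rates.boundedWeakStar [TopologicalSpace V] (r : Rates V) : TopologicalSpace r.L1 :=
  ⨆ ℓ : Ioi (0 : ℝ), TopologicalSpace.coinduced
    (Subtype.val : {Q : r.L1 // ‖Q‖ ≤ ℓ} → r.L1)
    (TopologicalSpace.induced Subtype.val r.weakStar)

/-- The space `L¹₊(E)` of nonnegative elements of `L¹(E)`. -/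
structure Rates.FlowSpace (r : Rates V) where
  /-- the underlying element of `L¹(E)` -/
  val : r.L1
  nonneg : ∀ e, 0 ≤ val e

/-- `L¹₊(E)` carries the relative topology of the bounded weak* topology. -/
instance [TopologicalSpace V] (r : Rates V) : TopologicalSpace r.FlowSpace :=
  TopologicalSpace.induced Rates.FlowSpace.val r.boundedWeakStar

open Classical in
/-- The inclusion `L¹₊(E) ⊆ [0,∞]^B`, extending flows by zero off `E`. -/
def Rates.FlowSpace.extend (r : Rates V) (Q : r.FlowSpace) : Bond V → ℝ≥0∞ :=
  fun e => if h : e ∈ r.edges then ENNReal.ofReal (Q.val ⟨e, h⟩) else 0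

end FlowSpace

/-! ### Exponential decay rates and exponential tightness -/

/-- `limsup_{T → ∞} T⁻¹ log P(A_T)`, with `log 0 = -∞`. -/
def expRate {Ω : Type*} [MeasurableSpace Ω] (P : Measure Ω) (A : ℝ≥0 → Set Ω) : EReal :=
  limsup (fun T : ℝ≥0 => (((T : ℝ)⁻¹ : ℝ) : EReal) * ENNReal.log (P (A T))) atTop

/-- Exponential tightness, as `T → ∞`, of the laws on `S` of variables `Z_T` under `P`. The space
`S` is viewed inside a larger set `S'` through `ι`, and `Z_T` is `S'`-valued: for every `M` there
is a compact `K ⊆ S` with `limsup T⁻¹ log P(Z_T ∉ K) ≤ -M`. -/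
def ExpTight {Ω S S' : Type*} [MeasurableSpace Ω] [TopologicalSpace S] (P : Measure Ω)
    (ι : S → S') (Z : ℝ≥0 → Ω → S') : Prop :=
  ∀ M : ℝ, ∃ K : Set S, IsCompact K ∧
    expRate P (fun T => {ω | Z T ω ∉ ι '' K}) ≤ ((-M : ℝ) : EReal)

end JumpChain

end

open JumpChain

noncomputable section

namespace JumpChain

/-! ### Markov property of the sampled jump chain -/

section SampleLaw

variable {V : Type*} [Countable V] [MeasurableSpace V] [MeasurableSingletonClass V]

/-! Both tails come from one exponential supermartingale. Give a path the weight `w y z` for each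
jump from `y` to `z` and the factor `exp ∫ (r(X_t) - ∑_z r(X_t,z) w(X_t,z)) dt`. The total weight up
to a fixed time `T` has expectation at most 1 (`Rates.lintegral_tsum_timeWeight_le`). On samples
this is elementary: tilting one exponential holding time shows that a single visit has mean weight
at most 1, and the inequalities for successive visits telescope over the number of jumps.

Take `w y z = (1 + σ) u_k(z) / u_k(y)`. With `N` jumps up to `T`, the jump weights multiply to `(1 +
σ)^N u_k(X_T) / u_k(x)`, which is at least `(1 + σ)^N c / C_x`. The potential is `(1 + σ)(-L u_k /
u_k) - σ r`; it converges to `(1 + σ) v - σ r ≥ σ v - C`, because `σ r ≤ v + C`. Fatou's lemma in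
`k` bounds the expectation of `exp (N log (1 + σ) + σ ∫ (v + C) dt - (σ + 1) C T)` by `C_x / c`
(`Rates.exists_exponential_bound`). The surplus factor `1 + σ` is what makes jumps count. As `N` and
`∫ (v + C) dt` are nonnegative, Chebyshev's inequality makes each of them exceed a large multiple of
`T` with arbitrarily fast exponential decay (`Rates.exists_exponential_tails`).

For compactness, `v + C` has finite sublevel sets, so bounding its integral gives a tight family of
measures. Nonnegative flows on `E` of bounded mass form a weak* compact set, and the empirical flow
almost surely vanishes off `E`.

The empirical flow is a sum over uncountably many times. It is controlled by measurable events that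
compare the path at successive points of finer and finer grids of `[0,T]`. -/

instance (r : Rates V) (x : V) : IsProbabilityMeasure (r.sampleLaw x) := by
  unfold Rates.sampleLaw; infer_instance

/-- The law of the first sample point. -/
lemma Rates.sampleLaw_map_zero (r : Rates V) (x : V) :
    (r.sampleLaw x).map (fun ω => ω 0) = (Measure.dirac x).prod (expMeasure 1) := by
  have hcomp : (fun ω : Sample V => ω 0) =
      (fun h : (Π _ : Finset.Iic 0, V × ℝ) => h ⟨0, Finset.mem_Iic.2 le_rfl⟩) ∘
        Preorder.frestrictLe 0 := rfl
  rw [hcomp, ← Measure.map_map (by fun_prop) (by fun_prop), Rates.sampleLaw, Kernel.trajMeasure,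
    Measure.map_comp _ _ (by fun_prop), Kernel.traj_map_frestrictLe, Kernel.partialTraj_self,
    Measure.id_comp, Measure.map_map (by fun_prop) (by fun_prop)]
  exact Measure.map_id

/-- Conditionally on the first `n + 1` sample points, the next one is drawn by `Rates.step`. -/
lemma Rates.lintegral_step (r : Rates V) (x : V) (n : ℕ) (F : Sample V → V × ℝ → ℝ≥0∞)
    (hF : Measurable (Function.uncurry F))
    (hadap : ∀ ω ω' : Sample V, (∀ i ≤ n, ω i = ω' i) → F ω = F ω') :
    ∫⁻ ω, F ω (ω (n + 1)) ∂r.sampleLaw x =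
      ∫⁻ ω, ∫⁻ z, F ω z ∂(r.step (ω n).1) ∂r.sampleLaw x := by
  -- A history is extended to a full sample by the arbitrary value `(x, 0)`, which `F` ignores by
  -- `hadap`.
  set e : (Π _ : Finset.Iic n, V × ℝ) → Sample V := fun h i =>
    if hi : i ≤ n then h ⟨i, Finset.mem_Iic.2 hi⟩ else (x, 0) with he
  have hem : Measurable e := by
    refine measurable_pi_lambda _ fun i => ?_
    by_cases hi : i ≤ n
    · simp only [he, hi, dif_pos]; exact measurable_pi_apply _
    · simp only [he, hi, dif_neg, not_false_eq_true]; exact measurable_const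
  have hFe : ∀ ω, F (e (Preorder.frestrictLe n ω)) = F ω := fun ω =>
    hadap _ _ fun i hi => by simp [he, hi, Preorder.frestrictLe]
  have hG : Measurable (Function.uncurry fun h z => F (e h) z) :=
    hF.comp ((hem.comp measurable_fst).prodMk measurable_snd)
  have key := Kernel.map_frestrictLe_trajMeasure_compProd_eq_map_trajMeasure
    (X := fun _ => V × ℝ) (μ₀ := (Measure.dirac x).prod (expMeasure 1))
    (κ := fun n => r.step.comap (fun h => (h ⟨n, Finset.mem_Iic.2 le_rfl⟩).1) (by fun_prop))
    (a := n)
  change (r.sampleLaw x).map _ ⊗ₘ _ = (r.sampleLaw x).map _ at key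
  have h1 : ∫⁻ ω, F ω (ω (n + 1)) ∂r.sampleLaw x =
      ∫⁻ p, Function.uncurry (fun h z => F (e h) z) p ∂((r.sampleLaw x).map
        (fun ω => (Preorder.frestrictLe n ω, ω (n + 1)))) := by
    rw [lintegral_map hG (by fun_prop)]
    simp only [Function.uncurry, hFe]
  rw [h1, ← key, Measure.lintegral_compProd hG, lintegral_map ?_ (by fun_prop)]
  · simp only [Function.uncurry, hFe, Kernel.comap_apply]
    rfl
  · exact hG.lintegral_kernel_prod_right'

end SampleLaw

/-! ### Exponential variables -/

lemma expMeasure_eq_withDensity (a : ℝ) :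
    expMeasure a = volume.withDensity (exponentialPDF a) := rfl

lemma measurable_exponentialPDF (a : ℝ) : Measurable (exponentialPDF a) :=
  (measurable_exponentialPDFReal a).ennreal_ofReal

lemma expMeasure_Iic {a : ℝ} (ha : 0 < a) {t : ℝ} (ht : 0 ≤ t) :
    expMeasure a (Iic t) = ENNReal.ofReal (1 - Real.exp (-(a * t))) := by
  rw [expMeasure_eq_withDensity, withDensity_apply _ measurableSet_Iic,
    lintegral_exponentialPDF_eq_antiDeriv ha, if_pos ht]

lemma expMeasure_Ioi {a : ℝ} (ha : 0 < a) {t : ℝ} (ht : 0 ≤ t) :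
    expMeasure a (Ioi t) = ENNReal.ofReal (Real.exp (-(a * t))) := by
  have := isProbabilityMeasure_expMeasure ha
  rw [← compl_Iic, prob_compl_eq_one_sub measurableSet_Iic, expMeasure_Iic ha ht,
    ← ENNReal.ofReal_one, ← ENNReal.ofReal_sub _ (by simp; positivity)]
  congr 1; ring

lemma ae_pos_expMeasure {a : ℝ} (ha : 0 < a) : ∀ᵐ t ∂expMeasure a, 0 < t := by
  have : {t : ℝ | ¬ 0 < t} = Iic 0 := by ext; simp
  rw [ae_iff, this, expMeasure_Iic ha le_rfl]; simp

/-- An exponential tilt of a unit exponential variable is an exponential variable. -/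
lemma lintegral_tilt_expMeasure {a t : ℝ} (ha : 0 ≤ a) (ht : 0 ≤ t) :
    ∫⁻ s in Iic t, ENNReal.ofReal (Real.exp ((1 - a) * s)) * ENNReal.ofReal a ∂expMeasure 1 =
      ENNReal.ofReal (1 - Real.exp (-(a * t))) := by
  rcases ha.eq_or_lt with rfl | ha
  · simp
  rw [← expMeasure_Iic ha ht, expMeasure_eq_withDensity, expMeasure_eq_withDensity,
    withDensity_apply _ measurableSet_Iic, restrict_withDensity measurableSet_Iic,
    lintegral_withDensity_eq_lintegral_mul _
      (measurable_exponentialPDF 1) (by fun_prop)]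
  congr 1 with s
  simp only [Pi.mul_apply, exponentialPDF_eq]
  split_ifs with hs
  · rw [← ENNReal.ofReal_mul (Real.exp_pos _).le, ← ENNReal.ofReal_mul (by positivity)]
    congr 1
    have : Real.exp (-(a * s)) = Real.exp (-(1 * s)) * Real.exp ((1 - a) * s) := by
      rw [← Real.exp_add]; ring_nf
    rw [this]; ring
  · simp

/-! ### Mean weight of a single visit -/

section Weights

variable {V : Type*}

/-- The time spent in a visited state. -/
def Rates.hold (r : Rates V) (p : V × ℝ) : ℝ≥0∞ := ENNReal.ofReal p.2 / (r.exit p.1 : ℝ≥0∞)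

lemma Rates.jumpTime_zero (r : Rates V) (ω : Sample V) : r.jumpTime ω 0 = 0 := by
  simp [Rates.jumpTime]

lemma Rates.jumpTime_succ (r : Rates V) (ω : Sample V) (n : ℕ) :
    r.jumpTime ω (n + 1) = r.jumpTime ω n + r.hold (ω n) := by
  simp [Rates.jumpTime, Rates.hold, Finset.sum_range_succ]

/-- The total weighted rate `∑_y r(x,y) w(x,y)`. -/
def Rates.tiltExit (r : Rates V) (w : V → V → ℝ≥0) (x : V) : ℝ≥0 := ∑' y, r.rate x y * w x y

/-- The potential `r(x) - ∑_y r(x,y) w(x,y)`. -/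
def Rates.pot (r : Rates V) (w : V → V → ℝ≥0) (x : V) : ℝ := r.exit x - r.tiltExit w x

lemma Rates.jump_apply (r : Rates V) {x : V} (h : r.exit x ≠ 0) (y : V) :
    r.jump x y = (r.rate x y : ℝ≥0∞) * (r.exit x : ℝ≥0∞)⁻¹ := by
  rw [Rates.jump, dif_neg h, PMF.normalize_apply, r.tsum_coe]

lemma Rates.hold_eq_ofReal (r : Rates V) {x : V} (h : r.exit x ≠ 0) (t : ℝ) :
    r.hold (x, t) = ENNReal.ofReal (t / r.exit x) := by
  rw [Rates.hold, ENNReal.ofReal_div_of_pos (by positivity), ENNReal.ofReal_coe_nnreal]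

variable [Countable V] [MeasurableSpace V] [MeasurableSingletonClass V]

/-- The mean weight of a jump from `x`. -/
def Rates.meanWeight (r : Rates V) (w : V → V → ℝ≥0) (x : V) : ℝ≥0∞ :=
  ∫⁻ y, w x y ∂(r.jump x).toMeasure

lemma Rates.meanWeight_eq (r : Rates V) {w : V → V → ℝ≥0} {x : V}
    (hw : Summable fun y => r.rate x y * w x y) (h : r.exit x ≠ 0) :
    r.meanWeight w x = ENNReal.ofReal (r.tiltExit w x / r.exit x) := by
  rw [Rates.meanWeight, lintegral_countable']
  have : ∀ y, (w x y : ℝ≥0∞) * (r.jump x).toMeasure {y} =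
      ((r.rate x y * w x y : ℝ≥0) : ℝ≥0∞) * (r.exit x : ℝ≥0∞)⁻¹ := fun y => by
    rw [PMF.toMeasure_apply_singleton _ _ (measurableSet_singleton y), r.jump_apply h]
    push_cast; ring
  simp_rw [this]
  rw [ENNReal.tsum_mul_right, ← ENNReal.coe_tsum hw, ← NNReal.coe_div, ENNReal.ofReal_coe_nnreal,
    ENNReal.coe_div h, ENNReal.div_eq_inv_mul, mul_comm]
  rfl

/-- The contribution of the visit of a state, when the time `s` is left. -/
def Rates.visitWeight (r : Rates V) (w : V → V → ℝ≥0) (p : V × ℝ) (s : ℝ≥0∞) : ℝ≥0∞ :=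
  if s < r.hold p then ENNReal.ofReal (Real.exp (r.pot w p.1 * s.toReal))
  else ENNReal.ofReal (Real.exp (r.pot w p.1 * (r.hold p).toReal)) * r.meanWeight w p.1

/-- Let `e` be the exit rate and `R` the weighted one. Staying beyond `s` has probability `exp (-e
s)` and weight `exp ((e - R) s)`, which contributes `exp (-R s)`. A jump before `s` contributes the
probability `1 - exp (-R s)` that an exponential variable of rate `R` is at most `s`, by tilting.
The two add up to 1. -/
lemma Rates.lintegral_visitWeight_le (r : Rates V) {w : V → V → ℝ≥0} {x : V}
    (hw : Summable fun y => r.rate x y * w x y) {s : ℝ≥0∞} (hs : s ≠ ∞) :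
    ∫⁻ t, r.visitWeight w (x, t) s ∂expMeasure 1 ≤ 1 := by
  by_cases h : r.exit x = 0
  · calc ∫⁻ t, r.visitWeight w (x, t) s ∂expMeasure 1 ≤ ∫⁻ _, 1 ∂expMeasure 1 := by
          refine lintegral_mono_ae ?_
          filter_upwards [ae_pos_expMeasure one_pos] with t ht
          have h1 : r.hold (x, t) = ∞ := by
            simp [Rates.hold, h, ENNReal.div_zero, ht]
          rw [Rates.visitWeight, h1, if_pos hs.lt_top, ENNReal.ofReal_le_one, Real.exp_le_one_iff]
          refine mul_nonpos_of_nonpos_of_nonneg ?_ ENNReal.toReal_nonneg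
          simp [Rates.pot, h]
      _ = 1 := by simp
  have hpos : (0 : ℝ) < r.exit x := by positivity
  set e : ℝ := NNReal.toReal (r.exit x) with he
  set R : ℝ := NNReal.toReal (r.tiltExit w x) with hR
  have hR0 : 0 ≤ R := NNReal.coe_nonneg _
  obtain ⟨σ, rfl⟩ : ∃ σ : ℝ≥0, s = σ := ⟨s.toNNReal, (ENNReal.coe_toNNReal hs).symm⟩
  have hse : 0 ≤ (σ : ℝ) * e := by positivity
  have hpot : r.pot w x = e - R := rfl
  -- Here `σ` is the time left. The holding time is `t / e`, so in the unit exponential variable `t`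
  -- the threshold is `σ * e` and the tilting parameter is `R / e`.
  have hle : ∀ᵐ t ∂expMeasure 1, r.visitWeight w (x, t) σ ≤
      (Ioi (σ * e)).indicator (fun _ => ENNReal.ofReal (Real.exp ((e - R) * σ))) t +
      (Iic (σ * e)).indicator (fun t => ENNReal.ofReal (Real.exp ((1 - R / e) * t)) *
        ENNReal.ofReal (R / e)) t := by
    filter_upwards [ae_pos_expMeasure one_pos] with t ht
    have hlt : (σ : ℝ≥0∞) < r.hold (x, t) ↔ σ * e < t := by
      rw [r.hold_eq_ofReal h, ← ENNReal.ofReal_coe_nnreal,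
        ENNReal.ofReal_lt_ofReal_iff_of_nonneg (by positivity), lt_div_iff₀ hpos]
    rw [Rates.visitWeight]
    by_cases hc : σ * e < t
    · rw [if_pos (hlt.2 hc), indicator_of_mem (mem_Ioi.2 hc)]
      exact le_add_right le_rfl
    · rw [if_neg (mt hlt.1 hc), indicator_of_mem (a := t) (mem_Iic.2 (not_lt.1 hc)),
        r.meanWeight_eq hw h, r.hold_eq_ofReal h, ENNReal.toReal_ofReal (by positivity), hpot]
      have harg : (e - R) * (t / e) = (1 - R / e) * t := by field_simp
      rw [← he, harg]
      exact le_add_left le_rfl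
  refine (lintegral_mono_ae hle).trans ?_
  rw [lintegral_add_left (by measurability), lintegral_indicator measurableSet_Ioi,
    lintegral_indicator measurableSet_Iic, lintegral_tilt_expMeasure (by positivity) hse,
    lintegral_const, Measure.restrict_apply MeasurableSet.univ, univ_inter,
    expMeasure_Ioi one_pos hse, ← ENNReal.ofReal_mul (Real.exp_pos _).le, ← Real.exp_add,
    ← ENNReal.ofReal_add (Real.exp_pos _).le]
  · rw [ENNReal.ofReal_le_one]
    have h1 : (e - R) * σ + -(1 * (σ * e)) = -(R * σ) := by ring
    have h2 : R / e * (σ * e) = R * σ := by field_simp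
    rw [h1, h2]; linarith
  · rw [sub_nonneg, Real.exp_le_one_iff, neg_nonpos]; positivity

lemma measurable_comp_fst {β : Type*} [MeasurableSpace β] (f : V → β) :
    Measurable fun p : V × ℝ => f p.1 :=
  (measurable_of_countable f).comp measurable_fst

lemma Rates.measurable_hold (r : Rates V) : Measurable r.hold :=
  Measurable.div (by fun_prop) (measurable_comp_fst fun x => (r.exit x : ℝ≥0∞))

lemma Rates.measurable_visitWeight (r : Rates V) (w : V → V → ℝ≥0) :
    Measurable (Function.uncurry (r.visitWeight w)) := by
  have h1 : Measurable fun q : (V × ℝ) × ℝ≥0∞ => r.hold q.1 := r.measurable_hold.comp measurable_fst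
  have h2 : Measurable fun q : (V × ℝ) × ℝ≥0∞ => r.pot w q.1.1 :=
    (measurable_comp_fst (r.pot w)).comp measurable_fst
  have h3 : Measurable fun q : (V × ℝ) × ℝ≥0∞ => r.meanWeight w q.1.1 :=
    (measurable_comp_fst (r.meanWeight w)).comp measurable_fst
  exact Measurable.ite (measurableSet_lt measurable_snd h1)
    (by fun_prop) (by fun_prop)

end Weights

/-! ### The exponential supermartingale -/

section Martingale

variable {V : Type*}

/-- The weight collected during the first `n` visits and jumps. -/
def Rates.pathWeight (r : Rates V) (w : V → V → ℝ≥0) (n : ℕ) (ω : Sample V) : ℝ≥0∞ :=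
  ∏ i ∈ Finset.range n, ((w (ω i).1 (ω (i + 1)).1 : ℝ≥0∞) *
    ENNReal.ofReal (Real.exp (r.pot w (ω i).1 * (r.hold (ω i)).toReal)))

open Classical in
/-- The weight collected up to time `T`, if exactly `n` jumps occur up to then. -/
def Rates.timeWeight (r : Rates V) (w : V → V → ℝ≥0) (T : ℝ≥0) (n : ℕ) (ω : Sample V) : ℝ≥0∞ :=
  if r.jumpTime ω n ≤ T ∧ T < r.jumpTime ω (n + 1) then
    r.pathWeight w n ω *
      ENNReal.ofReal (Real.exp (r.pot w (ω n).1 * ((T : ℝ≥0∞) - r.jumpTime ω n).toReal))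
  else 0

open Classical in
/-- The weight collected up to the `n + 1`-st jump, not counting this jump, if it occurs up to
time `T`. -/
def Rates.preJumpWeight (r : Rates V) (w : V → V → ℝ≥0) (T : ℝ≥0) (n : ℕ) (ω : Sample V) : ℝ≥0∞ :=
  if r.jumpTime ω (n + 1) ≤ T then
    r.pathWeight w n ω *
      ENNReal.ofReal (Real.exp (r.pot w (ω n).1 * (r.hold (ω n)).toReal))
  else 0

lemma Rates.jumpTime_congr (r : Rates V) {ω ω' : Sample V} {n : ℕ}
    (h : ∀ i < n, ω i = ω' i) : r.jumpTime ω n = r.jumpTime ω' n :=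
  Finset.sum_congr rfl fun i hi => by rw [h i (Finset.mem_range.1 hi)]

lemma Rates.preJumpWeight_congr (r : Rates V) (w : V → V → ℝ≥0) (T : ℝ≥0) {ω ω' : Sample V} {n : ℕ}
    (h : ∀ i ≤ n, ω i = ω' i) : r.preJumpWeight w T n ω = r.preJumpWeight w T n ω' := by
  have hp : r.pathWeight w n ω = r.pathWeight w n ω' := Finset.prod_congr rfl fun i hi => by
    have := Finset.mem_range.1 hi
    rw [h i (by omega), h (i + 1) (by omega)]
  rw [Rates.preJumpWeight, Rates.preJumpWeight, hp, h n le_rfl,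
    r.jumpTime_congr fun i hi => h i (by omega)]

variable [MeasurableSpace V]

open Classical in
-- Once visit `n` has begun by time `T`, either `T` falls within it or the next jump comes first.
-- These are the two branches of `visitWeight`, and the jump is counted by its mean weight.
lemma Rates.timeWeight_add (r : Rates V) (w : V → V → ℝ≥0) (T : ℝ≥0) (n : ℕ) (ω : Sample V) :
    r.timeWeight w T n ω + r.preJumpWeight w T n ω * r.meanWeight w (ω n).1 =
      if r.jumpTime ω n ≤ T then
        r.pathWeight w n ω * r.visitWeight w (ω n) (T - r.jumpTime ω n) else 0 := by
  rw [Rates.timeWeight, Rates.preJumpWeight, Rates.visitWeight]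
  by_cases h1 : r.jumpTime ω n ≤ T
  · have hlt : (T : ℝ≥0∞) < r.jumpTime ω (n + 1) ↔ (T : ℝ≥0∞) - r.jumpTime ω n < r.hold (ω n) := by
      rw [r.jumpTime_succ, ENNReal.sub_lt_iff_lt_left (h1.trans_lt ENNReal.coe_lt_top).ne h1]
    by_cases h2 : (T : ℝ≥0∞) < r.jumpTime ω (n + 1)
    · simp [h1, h2, not_le.2 h2, hlt.1 h2]
    · simp [h1, h2, not_lt.1 h2, mt hlt.2 h2, mul_assoc]
  · have h2 : ¬ r.jumpTime ω (n + 1) ≤ T := fun h => h1 ((r.jumpTime_mono ω n.le_succ).trans h)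
    simp [h1, h2]

variable [Countable V] [MeasurableSingletonClass V]

lemma measurable_sample_comp {β : Type*} [MeasurableSpace β] (f : V → β) (n : ℕ) :
    Measurable fun ω : Sample V => f (ω n).1 :=
  (measurable_of_countable f).comp (measurable_fst.comp (measurable_pi_apply n))

lemma Rates.measurable_hold_apply (r : Rates V) (n : ℕ) :
    Measurable fun ω : Sample V => r.hold (ω n) :=
  r.measurable_hold.comp (measurable_pi_apply n)

lemma measurable_sample_comp₂ {β : Type*} [MeasurableSpace β] (f : V → V → β) (n m : ℕ) :
    Measurable fun ω : Sample V => f (ω n).1 (ω m).1 :=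
  (measurable_of_countable (Function.uncurry f)).comp
    ((measurable_fst.comp (measurable_pi_apply n)).prodMk
      (measurable_fst.comp (measurable_pi_apply m)))

lemma Rates.measurable_pathWeight (r : Rates V) (w : V → V → ℝ≥0) (n : ℕ) :
    Measurable (r.pathWeight w n) := by
  refine Finset.measurable_prod _ fun i _ => ?_
  have h1 := measurable_sample_comp₂ (fun x y => (w x y : ℝ≥0∞)) i (i + 1)
  have h2 := measurable_sample_comp (r.pot w) i
  have h3 := r.measurable_hold_apply i
  fun_prop

lemma Rates.measurable_timeWeight (r : Rates V) (w : V → V → ℝ≥0) (T : ℝ≥0) (n : ℕ) :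
    Measurable (r.timeWeight w T n) := by
  have h1 := r.measurable_pathWeight w n
  have h2 := measurable_sample_comp (r.pot w) n
  have h3 := r.measurable_jumpTime n
  refine Measurable.ite ?_ (by fun_prop) measurable_const
  exact (measurableSet_le h3 measurable_const).inter
    (measurableSet_lt measurable_const (r.measurable_jumpTime (n + 1)))

lemma Rates.measurable_preJumpWeight (r : Rates V) (w : V → V → ℝ≥0) (T : ℝ≥0) (n : ℕ) :
    Measurable (r.preJumpWeight w T n) := by
  have h1 := r.measurable_pathWeight w n
  have h2 := measurable_sample_comp (r.pot w) n
  have h3 := r.measurable_hold_apply n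
  exact Measurable.ite (measurableSet_le (r.measurable_jumpTime (n + 1)) measurable_const)
    (by fun_prop) measurable_const

lemma Rates.step_apply (r : Rates V) (x : V) :
    r.step x = (r.jump x).toMeasure.prod (expMeasure 1) := rfl

/-- A sample of the visit following a jump from `y` collects at most the mean weight of the jump. -/
lemma Rates.lintegral_step_visitWeight_le (r : Rates V) {w : V → V → ℝ≥0}
    (hw : ∀ x, Summable fun y => r.rate x y * w x y) (y : V) {s : ℝ≥0∞} (hs : s ≠ ∞) :
    ∫⁻ z, (w y z.1 : ℝ≥0∞) * r.visitWeight w z s ∂r.step y ≤ r.meanWeight w y := by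
  have hv : Measurable fun z => r.visitWeight w z s :=
    (r.measurable_visitWeight w).comp (measurable_id.prodMk measurable_const)
  have hm : Measurable fun z : V × ℝ => (w y z.1 : ℝ≥0∞) * r.visitWeight w z s :=
    (measurable_comp_fst fun z => (w y z : ℝ≥0∞)).mul hv
  rw [r.step_apply, lintegral_prod _ hm.aemeasurable]
  refine lintegral_mono fun z => ?_
  dsimp only
  rw [lintegral_const_mul _ (by exact hv.comp measurable_prodMk_left)]
  exact mul_le_of_le_one_right' (r.lintegral_visitWeight_le (hw z) hs)

/-- The telescoping step: the remainder left by visit `n` pays for the event that `T` falls in visit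
`n + 1` and for the remainder left by that visit. Conditioning on the first `n + 1` sample points
replaces the next jump by its mean weight, as the visit after it has mean weight at most 1. -/
lemma Rates.lintegral_timeWeight_succ_le (r : Rates V) {w : V → V → ℝ≥0}
    (hw : ∀ x, Summable fun y => r.rate x y * w x y) (T : ℝ≥0) (x : V) (n : ℕ) :
    ∫⁻ ω, r.timeWeight w T (n + 1) ω ∂r.sampleLaw x +
        ∫⁻ ω, r.preJumpWeight w T (n + 1) ω * r.meanWeight w (ω (n + 1)).1 ∂r.sampleLaw x ≤
      ∫⁻ ω, r.preJumpWeight w T n ω * r.meanWeight w (ω n).1 ∂r.sampleLaw x := by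
  classical
  rw [← lintegral_add_left (r.measurable_timeWeight w T _)]
  simp_rw [r.timeWeight_add]
  set F : Sample V → V × ℝ → ℝ≥0∞ := fun ω z => r.preJumpWeight w T n ω *
    ((w (ω n).1 z.1 : ℝ≥0∞) * r.visitWeight w z (T - r.jumpTime ω (n + 1))) with hF
  have hFm : Measurable (Function.uncurry F) := by
    have h1 : Measurable fun q : Sample V × (V × ℝ) => r.preJumpWeight w T n q.1 :=
      (r.measurable_preJumpWeight w T n).comp measurable_fst
    have h2 : Measurable fun q : Sample V × (V × ℝ) => (w (q.1 n).1 q.2.1 : ℝ≥0∞) :=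
      (measurable_of_countable (Function.uncurry fun x y => (w x y : ℝ≥0∞))).comp
        (by fun_prop : Measurable fun q : Sample V × (V × ℝ) => ((q.1 n).1, q.2.1))
    have h3 : Measurable fun q : Sample V × (V × ℝ) =>
        r.visitWeight w q.2 (T - r.jumpTime q.1 (n + 1)) :=
      (r.measurable_visitWeight w).comp (measurable_snd.prodMk
        (measurable_const.sub ((r.measurable_jumpTime (n + 1)).comp measurable_fst)))
    exact h1.mul (h2.mul h3)
  have hFa : ∀ ω ω' : Sample V, (∀ i ≤ n, ω i = ω' i) → F ω = F ω' := fun ω ω' h => by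
    simp only [hF]
    rw [r.preJumpWeight_congr w T h, h n le_rfl, r.jumpTime_congr fun i hi => h i (by omega)]
  have hFe : ∀ ω : Sample V, (if r.jumpTime ω (n + 1) ≤ T then r.pathWeight w (n + 1) ω *
      r.visitWeight w (ω (n + 1)) (T - r.jumpTime ω (n + 1)) else 0) = F ω (ω (n + 1)) := fun ω => by
    simp only [hF, Rates.preJumpWeight]
    split_ifs with h
    · rw [Rates.pathWeight, Finset.prod_range_succ, ← Rates.pathWeight]; ring
    · simp
  simp_rw [hFe]
  rw [r.lintegral_step x n F hFm hFa]
  refine lintegral_mono fun ω => ?_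
  simp only [hF]
  rw [lintegral_const_mul]
  · gcongr
    exact r.lintegral_step_visitWeight_le hw _ (ENNReal.sub_ne_top ENNReal.coe_ne_top)
  · exact (measurable_comp_fst fun z => (w (ω n).1 z : ℝ≥0∞)).mul
      ((r.measurable_visitWeight w).comp (measurable_id.prodMk measurable_const))

lemma Rates.lintegral_timeWeight_zero_le (r : Rates V) {w : V → V → ℝ≥0}
    (hw : ∀ x, Summable fun y => r.rate x y * w x y) (T : ℝ≥0) (x : V) :
    ∫⁻ ω, r.timeWeight w T 0 ω ∂r.sampleLaw x +
        ∫⁻ ω, r.preJumpWeight w T 0 ω * r.meanWeight w (ω 0).1 ∂r.sampleLaw x ≤ 1 := by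
  classical
  have hv : Measurable fun z => r.visitWeight w z T :=
    (r.measurable_visitWeight w).comp (measurable_id.prodMk measurable_const)
  rw [← lintegral_add_left (r.measurable_timeWeight w T _)]
  simp_rw [r.timeWeight_add]
  simp only [r.jumpTime_zero, zero_le, if_true, Rates.pathWeight, Finset.range_zero,
    Finset.prod_empty, one_mul, tsub_zero]
  rw [← lintegral_map (f := fun z => r.visitWeight w z T) (g := fun ω : Sample V => ω 0) hv
    (measurable_pi_apply 0), r.sampleLaw_map_zero,
    lintegral_prod _ hv.aemeasurable, lintegral_dirac]
  exact r.lintegral_visitWeight_le (hw x) ENNReal.coe_ne_top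

/-- The exponential supermartingale inequality for the chain. -/
theorem Rates.lintegral_tsum_timeWeight_le (r : Rates V) {w : V → V → ℝ≥0}
    (hw : ∀ x, Summable fun y => r.rate x y * w x y) (T : ℝ≥0) (x : V) :
    ∫⁻ ω, ∑' n, r.timeWeight w T n ω ∂r.sampleLaw x ≤ 1 := by
  rw [lintegral_tsum fun n => (r.measurable_timeWeight w T n).aemeasurable]
  -- The induction carries the remainder after visit `n`, which is dropped at the end.
  have key : ∀ n, ∑ k ∈ Finset.range (n + 1), ∫⁻ ω, r.timeWeight w T k ω ∂r.sampleLaw x +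
      ∫⁻ ω, r.preJumpWeight w T n ω * r.meanWeight w (ω n).1 ∂r.sampleLaw x ≤ 1 := by
    intro n
    induction n with
    | zero => simpa using r.lintegral_timeWeight_zero_le hw T x
    | succ n ih =>
      rw [Finset.sum_range_succ, add_assoc]
      exact (add_le_add_right (r.lintegral_timeWeight_succ_le hw T x n) _).trans ih
  rw [ENNReal.tsum_eq_iSup_nat]
  refine iSup_le fun n => ?_
  exact (Finset.sum_le_sum_of_subset (Finset.range_mono n.le_succ)).trans
    (le_self_add.trans (key n))

end Martingale

/-! ### Lyapunov weights and the exponential bound -/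

section Lyapunov

variable {V : Type*}

/-- The integral `∫_0^T g(X_t) dt`, when `n` jumps occur up to time `T`. -/
def Rates.occupation (r : Rates V) (g : V → ℝ) (T : ℝ≥0) (n : ℕ) (ω : Sample V) : ℝ :=
  ∑ i ∈ Finset.range n, g (ω i).1 * (r.hold (ω i)).toReal +
    g (ω n).1 * ((T : ℝ≥0∞) - r.jumpTime ω n).toReal

lemma Rates.occupation_mono (r : Rates V) {g g' : V → ℝ} (h : ∀ y, g y ≤ g' y) (T : ℝ≥0) (n : ℕ)
    (ω : Sample V) : r.occupation g T n ω ≤ r.occupation g' T n ω :=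
  add_le_add (Finset.sum_le_sum fun _ _ => mul_le_mul_of_nonneg_right (h _) ENNReal.toReal_nonneg)
    (mul_le_mul_of_nonneg_right (h _) ENNReal.toReal_nonneg)

lemma Rates.occupation_nonneg (r : Rates V) {g : V → ℝ} (h : ∀ y, 0 ≤ g y) (T : ℝ≥0) (n : ℕ)
    (ω : Sample V) : 0 ≤ r.occupation g T n ω :=
  add_nonneg (Finset.sum_nonneg fun _ _ => mul_nonneg (h _) ENNReal.toReal_nonneg)
    (mul_nonneg (h _) ENNReal.toReal_nonneg)

lemma Rates.tendsto_occupation (r : Rates V) {g : ℕ → V → ℝ} {g' : V → ℝ}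
    (h : ∀ y, Tendsto (fun k => g k y) atTop (𝓝 (g' y))) (T : ℝ≥0) (n : ℕ) (ω : Sample V) :
    Tendsto (fun k => r.occupation (g k) T n ω) atTop (𝓝 (r.occupation g' T n ω)) :=
  (tendsto_finsetSum _ fun _ _ => (h _).mul_const _).add ((h _).mul_const _)

lemma Rates.hold_ne_top (r : Rates V) {ω : Sample V} {n : ℕ} {t : ℝ≥0}
    (h : r.jumpTime ω n ≤ t) {i : ℕ} (hi : i < n) : r.hold (ω i) ≠ ∞ := by
  have : r.hold (ω i) ≤ r.jumpTime ω n :=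
    Finset.single_le_sum (f := fun i => ENNReal.ofReal (ω i).2 / (r.exit (ω i).1 : ℝ≥0∞))
      (fun _ _ => zero_le) (Finset.mem_range.2 hi)
  exact ((this.trans h).trans_lt ENNReal.coe_lt_top).ne

lemma Rates.sum_hold (r : Rates V) {ω : Sample V} {n : ℕ} {T : ℝ≥0} (h : r.jumpTime ω n ≤ T) :
    ∑ i ∈ Finset.range n, (r.hold (ω i)).toReal + ((T : ℝ≥0∞) - r.jumpTime ω n).toReal = T := by
  rw [← ENNReal.toReal_sum fun i hi => r.hold_ne_top h (Finset.mem_range.1 hi),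
    ENNReal.toReal_sub_of_le h ENNReal.coe_ne_top]
  change (r.jumpTime ω n).toReal + _ = _
  simp

lemma Rates.occupation_affine (r : Rates V) (g : V → ℝ) (a b : ℝ) {T : ℝ≥0} {n : ℕ}
    {ω : Sample V} (h : r.jumpTime ω n ≤ T) :
    r.occupation (fun y => a * g y + b) T n ω = a * r.occupation g T n ω + b * T := by
  rw [← r.sum_hold h, Rates.occupation, Rates.occupation]
  simp only [add_mul, mul_add, Finset.sum_add_distrib, Finset.mul_sum, mul_assoc]
  ring

lemma Rates.timeWeight_eq (r : Rates V) (w : V → V → ℝ≥0) {T : ℝ≥0} {n : ℕ} {ω : Sample V}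
    (h₁ : r.jumpTime ω n ≤ T) (h₂ : T < r.jumpTime ω (n + 1)) :
    r.timeWeight w T n ω = ((∏ i ∈ Finset.range n, w (ω i).1 (ω (i + 1)).1 : ℝ≥0) : ℝ≥0∞) *
      ENNReal.ofReal (Real.exp (r.occupation (r.pot w) T n ω)) := by
  rw [Rates.timeWeight, if_pos ⟨h₁, h₂⟩, Rates.pathWeight, Finset.prod_mul_distrib,
    Rates.occupation, Real.exp_add, Real.exp_sum, ENNReal.ofReal_mul (by positivity),
    ENNReal.ofReal_prod_of_nonneg (fun i _ => (Real.exp_pos _).le), mul_assoc]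
  push_cast
  rfl

/-- The weights `θ u(y) / u(x)`. -/
def ratioWeight (θ : ℝ) (u : V → ℝ) (x y : V) : ℝ≥0 := (θ * u y / u x).toNNReal

lemma coe_ratioWeight {θ : ℝ} (hθ : 0 ≤ θ) {u : V → ℝ} (hu : ∀ x, 0 < u x) (x y : V) :
    (ratioWeight θ u x y : ℝ) = θ * u y / u x :=
  Real.coe_toNNReal _ (div_nonneg (mul_nonneg hθ (hu y).le) (hu x).le)

lemma prod_ratioWeight {θ : ℝ} (hθ : 0 ≤ θ) {u : V → ℝ} (hu : ∀ x, 0 < u x) (ω : Sample V) (n : ℕ) :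
    ((∏ i ∈ Finset.range n, ratioWeight θ u (ω i).1 (ω (i + 1)).1 : ℝ≥0) : ℝ) =
      θ ^ n * (u (ω n).1 / u (ω 0).1) := by
  induction n with
  | zero => simp [div_self (hu _).ne']
  | succ n ih =>
    rw [Finset.prod_range_succ, NNReal.coe_mul, ih, coe_ratioWeight hθ hu]
    have := (hu (ω n).1).ne'
    have := (hu (ω 0).1).ne'
    field_simp
    ring

lemma Rates.summable_ratioWeight (r : Rates V) {θ : ℝ} (hθ : 0 ≤ θ) {u : V → ℝ} (hu : ∀ x, 0 < u x)
    {x : V} (hs : Summable fun y => (r.rate x y : ℝ) * u y) :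
    Summable fun y => r.rate x y * ratioWeight θ u x y := by
  rw [← NNReal.summable_coe]
  refine (hs.mul_left (θ / u x)).congr fun y => ?_
  rw [NNReal.coe_mul, coe_ratioWeight hθ hu]; ring

/-- For `θ = 1` this is the usual potential `-L u / u`. Rewarding every jump by `θ > 1` costs the
extra `(θ - 1) r`, which the bound `σ r ≤ v + C` pays for. -/
lemma Rates.pot_ratioWeight (r : Rates V) {θ : ℝ} (hθ : 0 ≤ θ) {u : V → ℝ} (hu : ∀ x, 0 < u x)
    {x : V} (hs : Summable fun y => (r.rate x y : ℝ) * u y) :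
    r.pot (ratioWeight θ u) x = θ * (-r.gen u x / u x) - (θ - 1) * r.exit x := by
  have hr : Summable fun y => (r.rate x y : ℝ) := NNReal.summable_coe.2 (r.summable_rate x)
  have h1 : (r.tiltExit (ratioWeight θ u) x : ℝ) =
      θ / u x * ∑' y, (r.rate x y : ℝ) * u y := by
    rw [Rates.tiltExit, NNReal.coe_tsum, ← tsum_mul_left]
    congr 1 with y
    rw [NNReal.coe_mul, coe_ratioWeight hθ hu]; ring
  have h2 : r.gen u x = ∑' y, (r.rate x y : ℝ) * u y - r.exit x * u x := by
    rw [Rates.gen, Rates.exit, NNReal.coe_tsum, ← tsum_mul_right,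
      ← hs.tsum_sub (hr.mul_right _)]
    congr 1 with y
    ring
  have := (hu x).ne'
  rw [Rates.pot, h1, h2]
  field_simp
  ring

variable [Countable V] [MeasurableSpace V] [MeasurableSingletonClass V]

/-- The exponential bound on the number of jumps and on the additive functional of a function `f`
with finite sublevel sets. -/
theorem Rates.exists_exponential_bound (r : Rates V) (hC : r.CompactnessCondition) (x : V) :
    ∃ (f : V → ℝ≥0) (σ lam b κ : ℝ), 0 < σ ∧ 0 < lam ∧ (∀ a : ℝ≥0, {y | f y ≤ a}.Finite) ∧
      ∀ T : ℝ≥0, ∃ G : Sample V → ℝ≥0∞, Measurable G ∧ ∫⁻ ω, G ω ∂r.sampleLaw x ≤ 1 ∧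
        ∀ (ω : Sample V) (n : ℕ), (ω 0).1 = x → r.jumpTime ω n ≤ T → T < r.jumpTime ω (n + 1) →
          ENNReal.ofReal (Real.exp (lam * n + σ * r.occupation (fun y => f y) T n ω - b * T - κ)) ≤
            G ω := by
  obtain ⟨u, hu, hsum, ⟨c, hc, hcu⟩, hup, v, hv, hfin, σ, C, hσ, hC0, hvr⟩ := hC
  obtain ⟨D, hD⟩ := hup x
  have hDpos : 0 < D := (hu 0 x).trans_le (hD 0)
  have hθ : (0 : ℝ) ≤ 1 + σ := by linarith
  have hvC : ∀ y, 0 ≤ v y + C := fun y => by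
    have := hvr y
    have : 0 ≤ σ * (r.exit y : ℝ) := by positivity
    linarith
  -- The choice `θ = 1 + σ` makes the cost per unit time exactly `σ r`. The last constant comes from
  -- `u k (X_T) / u k x ≥ c / D`.
  refine ⟨fun y => (v y + C).toNNReal, σ, Real.log (1 + σ), (σ + 1) * C, Real.log (D / c), hσ,
    Real.log_pos (by linarith), fun a => ?_, fun T => ?_⟩
  · refine (hfin a).subset fun y hy => ?_
    have h1 : v y + C ≤ a := (Real.toNNReal_le_iff_le_coe).1 hy
    simp only [mem_ofPred_eq]; linarith
  set w : ℕ → V → V → ℝ≥0 := fun k => ratioWeight (1 + σ) (u k) with hw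
  have hm : ∀ k, Measurable fun ω => ∑' n, r.timeWeight (w k) T n ω := fun k =>
    Measurable.tsum fun n => r.measurable_timeWeight (w k) T n
  -- Fatou's lemma passes the bound 1 to the liminf, so pointwise convergence of the potentials
  -- suffices.
  refine ⟨fun ω => liminf (fun k => ∑' n, r.timeWeight (w k) T n ω) atTop, .liminf hm, ?_, ?_⟩
  · refine (lintegral_liminf_le hm).trans ?_
    refine (liminf_le_liminf (Eventually.of_forall fun k => r.lintegral_tsum_timeWeight_le
      (fun y => r.summable_ratioWeight hθ (hu k) (hsum k y)) T x)).trans ?_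
    simp
  · intro ω n h0 h₁ h₂
    set p : V → ℝ := fun y => (1 + σ) * v y - (1 + σ - 1) * r.exit y with hp
    have hlim : Tendsto (fun k => ENNReal.ofReal ((1 + σ) ^ n * (c / D) *
        Real.exp (r.occupation (r.pot (w k)) T n ω))) atTop
        (𝓝 (ENNReal.ofReal ((1 + σ) ^ n * (c / D) * Real.exp (r.occupation p T n ω)))) := by
      refine ENNReal.tendsto_ofReal (Tendsto.const_mul _ ((Real.continuous_exp.tendsto _).comp
        (r.tendsto_occupation (fun y => ?_) T n ω)))
      simp_rw [hw, fun k => r.pot_ratioWeight hθ (hu k) (hsum k y)]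
      exact ((hv y).const_mul _).sub_const _
    have hle : ∀ k, ENNReal.ofReal ((1 + σ) ^ n * (c / D) *
        Real.exp (r.occupation (r.pot (w k)) T n ω)) ≤ ∑' n, r.timeWeight (w k) T n ω := fun k => by
      refine le_trans ?_ (ENNReal.le_tsum n)
      rw [r.timeWeight_eq (w k) h₁ h₂, ENNReal.ofReal_mul (by positivity),
        ← ENNReal.ofReal_coe_nnreal, prod_ratioWeight hθ (hu k), h0]
      gcongr
      · exact (hu k _).le
      · exact hu k x
      · exact hcu k _
      · exact hD k
    refine le_trans (ENNReal.ofReal_le_ofReal ?_) (hlim.liminf_eq.symm.le.trans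
      (liminf_le_liminf (Eventually.of_forall hle)))
    -- From `σ r ≤ v + C` one gets `(1 + σ) v - σ r ≥ σ v - C = σ (v + C) - (σ + 1) C`. The constant
    -- integrates to a multiple of `T`.
    have hocc : σ * r.occupation (fun y => ((v y + C).toNNReal : ℝ)) T n ω - (σ + 1) * C * T ≤
        r.occupation p T n ω := by
      rw [sub_eq_add_neg, ← neg_mul, ← r.occupation_affine _ _ _ h₁]
      refine r.occupation_mono (fun y => ?_) T n ω
      rw [Real.coe_toNNReal _ (hvC y)]
      have := hvr y
      simp only [hp]
      linarith
    have hexp : (1 + σ) ^ n * (c / D) = Real.exp (Real.log (1 + σ) * n - Real.log (D / c)) := by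
      rw [Real.exp_sub, Real.exp_log (by positivity), mul_comm (Real.log _), Real.exp_nat_mul,
        Real.exp_log (by positivity)]
      field_simp
    rw [hexp, ← Real.exp_add, Real.exp_le_exp]
    linarith

end Lyapunov

/-! ### Grids of the time interval -/

section Grid

/-- The points `T k / n` of the grid of mesh `T / n`. -/
def gridPoint (T : ℝ≥0) (n k : ℕ) : ℝ≥0 := T * k / n

/-- The index of the cell `(T k / n, T (k + 1) / n]` that contains `t`. -/
def gridCell (T : ℝ≥0) (n : ℕ) (t : ℝ≥0) : ℕ := ⌈t * n / T⌉₊ - 1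

lemma gridPoint_mono (T : ℝ≥0) (n : ℕ) : Monotone (gridPoint T n) := fun a b h => by
  unfold gridPoint
  gcongr

lemma gridPoint_self (T : ℝ≥0) {n : ℕ} (hn : 0 < n) : gridPoint T n n = T := by
  have : (n : ℝ≥0) ≠ 0 := by positivity
  rw [gridPoint, mul_div_assoc, div_self this, mul_one]

lemma gridPoint_succ (T : ℝ≥0) (n k : ℕ) : gridPoint T n (k + 1) = gridPoint T n k + T / n := by
  simp only [gridPoint]
  push_cast
  ring

variable {T t : ℝ≥0} {n : ℕ}

/-- For `t > 0` the ceiling is positive, so the truncated subtraction in `gridCell` is a true one.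
-/
lemma gridCell_add_one (hT : 0 < T) (ht : 0 < t) (hn : 0 < n) :
    gridCell T n t + 1 = ⌈t * n / T⌉₊ := by
  have : 0 < ⌈t * n / T⌉₊ := Nat.ceil_pos.2 (by positivity)
  rw [gridCell]; omega

lemma le_gridPoint_gridCell_succ (hT : 0 < T) (ht : 0 < t) (hn : 0 < n) :
    t ≤ gridPoint T n (gridCell T n t + 1) := by
  have hn' : (0 : ℝ≥0) < n := by positivity
  rw [gridCell_add_one hT ht hn, gridPoint, le_div_iff₀ hn', mul_comm T, ← div_le_iff₀ hT]
  exact Nat.le_ceil _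

lemma gridPoint_gridCell_lt (hT : 0 < T) (ht : 0 < t) (hn : 0 < n) :
    gridPoint T n (gridCell T n t) < t := by
  have hn' : (0 : ℝ≥0) < n := by positivity
  rw [gridPoint, div_lt_iff₀ hn', mul_comm T, ← lt_div_iff₀ hT, ← Nat.lt_ceil,
    ← gridCell_add_one hT ht hn]
  exact Nat.lt_succ_self _

lemma gridCell_lt (hT : 0 < T) (ht : 0 < t) (htT : t ≤ T) (hn : 0 < n) : gridCell T n t < n := by
  by_contra! h
  have := (gridPoint_mono T n h).trans_lt (gridPoint_gridCell_lt hT ht hn)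
  rw [gridPoint_self T hn] at this
  exact absurd htT (not_le.2 this)

lemma tendsto_mesh (T : ℝ≥0) : Tendsto (fun n : ℕ => T / n) atTop (𝓝 0) :=
  tendsto_const_div_atTop_nhds_zero_nat T

/-- Cells are open on the left and closed on the right, so the left end stays strictly below `t` and
sees the left limit there. The right end stays at or above `t` and sees the value. -/
lemma tendsto_gridPoint_left (hT : 0 < T) (ht : 0 < t) :
    Tendsto (fun n => gridPoint T n (gridCell T n t)) atTop (𝓝[<] t) := by
  refine tendsto_nhdsWithin_iff.2 ⟨?_, ?_⟩
  · have h1 : Tendsto (fun n : ℕ => t - T / n) atTop (𝓝 t) := by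
      simpa using tendsto_const_nhds.sub (tendsto_mesh T)
    refine tendsto_of_tendsto_of_tendsto_of_le_of_le' h1 tendsto_const_nhds ?_ ?_
    · filter_upwards [eventually_gt_atTop 0] with n hn
      rw [tsub_le_iff_right, ← gridPoint_succ]
      exact le_gridPoint_gridCell_succ hT ht hn
    · filter_upwards [eventually_gt_atTop 0] with n hn
      exact (gridPoint_gridCell_lt hT ht hn).le
  · filter_upwards [eventually_gt_atTop 0] with n hn
    exact gridPoint_gridCell_lt hT ht hn

lemma tendsto_gridPoint_right (hT : 0 < T) (ht : 0 < t) :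
    Tendsto (fun n => gridPoint T n (gridCell T n t + 1)) atTop (𝓝[≥] t) := by
  refine tendsto_nhdsWithin_iff.2 ⟨?_, ?_⟩
  · have h1 := ((tendsto_gridPoint_left hT ht).mono_right nhdsWithin_le_nhds).add (tendsto_mesh T)
    rw [add_zero] at h1
    exact h1.congr fun n => (gridPoint_succ T n _).symm
  · filter_upwards [eventually_gt_atTop 0] with n hn
    exact le_gridPoint_gridCell_succ hT ht hn

end Grid

/-! ### Measurable control of the empirical flow by grids -/

section Paths

variable {V : Type*} [TopologicalSpace V] [DiscreteTopology V]

omit [DiscreteTopology V] in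
lemma PathSpace.leftLim_zero (X : PathSpace V) : Function.leftLim (X : ℝ≥0 → V) 0 = X 0 :=
  leftLim_eq_of_eq_bot _ (by
    have : Iio (0 : ℝ≥0) = ∅ := by ext s; simp
    rw [this, nhdsWithin_empty])

/-- In a discrete space, convergence means being eventually equal to the limit. -/
lemma PathSpace.eventually_left (X : PathSpace V) {t : ℝ≥0} (ht : 0 < t) :
    ∀ᶠ s in 𝓝[<] t, X s = Function.leftLim (X : ℝ≥0 → V) t := by
  obtain ⟨y, hy⟩ := (X.cadlag t).2
  have : (𝓝[<] t).NeBot := nhdsLT_neBot_of_exists_lt ⟨0, ht⟩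
  rw [leftLim_eq_of_tendsto hy]
  rw [nhds_discrete] at hy
  exact tendsto_pure.1 hy

lemma PathSpace.eventually_right (X : PathSpace V) (t : ℝ≥0) :
    ∀ᶠ s in 𝓝[≥] t, X s = X t := by
  have := (X.cadlag t).1
  rw [ContinuousWithinAt, nhds_discrete] at this
  exact tendsto_pure.1 this

/-- A jump is eventually seen on the cell of the grid that contains its time. -/
lemma PathSpace.eventually_gridPoint (X : PathSpace V) {T t : ℝ≥0} (hT : 0 < T) (ht : 0 < t) :
    ∀ᶠ n in atTop, X (gridPoint T n (gridCell T n t)) = Function.leftLim (X : ℝ≥0 → V) t ∧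
      X (gridPoint T n (gridCell T n t + 1)) = X t :=
  ((tendsto_gridPoint_left hT ht).eventually (X.eventually_left ht)).and
    ((tendsto_gridPoint_right hT ht).eventually (X.eventually_right t))

open Classical in
/-- The number of cells of the grid of `[0,T]` between whose end points the path changes. -/
def gridJumps (T : ℝ≥0) (n : ℕ) (X : PathSpace V) : ℝ≥0∞ :=
  ∑ k ∈ Finset.range n, if X (gridPoint T n k) ≠ X (gridPoint T n (k + 1)) then 1 else 0

/-- The number of jumps up to time `T` is at most the limit of its grid approximations. -/
lemma PathSpace.card_jumps_le (X : PathSpace V) {T : ℝ≥0} (hT : 0 < T) (s : Finset ℝ≥0)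
    (hs : ∀ t ∈ s, t ≤ T ∧ Function.leftLim (X : ℝ≥0 → V) t ≠ X t) :
    (s.card : ℝ≥0∞) ≤ liminf (fun n => gridJumps T n X) atTop := by
  classical
  have hpos : ∀ t ∈ s, 0 < t := fun t ht => pos_iff_ne_zero.2 fun h =>
    (hs t ht).2 (by rw [h]; exact X.leftLim_zero)
  have h1 : ∀ᶠ n in atTop, ∀ t ∈ s, X (gridPoint T n (gridCell T n t)) ≠
      X (gridPoint T n (gridCell T n t + 1)) := by
    rw [Filter.eventually_all_finset]
    intro t ht
    filter_upwards [X.eventually_gridPoint hT (hpos t ht)] with n hn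
    rw [hn.1, hn.2]
    exact (hs t ht).2
  -- Fine grids put the finitely many jump times in distinct cells, so each is counted separately.
  have h2 : ∀ᶠ n in atTop, ∀ t ∈ s, ∀ t' ∈ s, t' < t → t' < gridPoint T n (gridCell T n t) := by
    rw [Filter.eventually_all_finset]
    intro t ht
    rw [Filter.eventually_all_finset]
    intro t' _
    by_cases h : t' < t
    · filter_upwards [((tendsto_gridPoint_left hT (hpos t ht)).mono_right
        nhdsWithin_le_nhds).eventually (lt_mem_nhds h)] with n hn _
      exact hn
    · exact Eventually.of_forall fun n h' => absurd h' h
  refine le_liminf_of_le (by isBoundedDefault) ?_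
  filter_upwards [h1, h2, eventually_gt_atTop 0] with n h1 h2 hn
  have hne : ∀ t ∈ s, ∀ t' ∈ s, t' < t → gridCell T n t' ≠ gridCell T n t := fun t ht t' ht' h he =>
    absurd (h2 t ht t' ht' h) (not_lt.2 (by
      rw [← he]; exact (gridPoint_gridCell_lt hT (hpos t' ht') hn).le))
  have hinj : Set.InjOn (gridCell T n) s := fun t ht t' ht' he => by
    rcases lt_trichotomy t t' with h | h | h
    · exact absurd he (hne t' ht' t ht h)
    · exact h
    · exact absurd he.symm (hne t ht t' ht' h)
  rw [gridJumps, Finset.sum_boole, ← Finset.card_image_of_injOn hinj, Nat.cast_le]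
  refine Finset.card_le_card fun k hk => ?_
  obtain ⟨t, ht, rfl⟩ := Finset.mem_image.1 hk
  exact Finset.mem_filter.2 ⟨Finset.mem_range.2 (gridCell_lt hT (hpos t ht) (hs t ht).1 hn),
    h1 t ht⟩

/-- After exchanging the sums, each time contributes to at most one bond, and only if it is a jump
time. The sum over times is a supremum over finite sets, to which `PathSpace.card_jumps_le` applies.
-/
lemma flowNorm_empFlow_le (X : PathSpace V) {T : ℝ≥0} (hT : 0 < T) :
    flowNorm (empFlow T X) ≤ (T : ℝ≥0∞)⁻¹ * liminf (fun n => gridJumps T n X) atTop := by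
  classical
  rw [flowNorm]
  simp only [empFlow]
  rw [ENNReal.tsum_mul_left, ENNReal.tsum_comm]
  gcongr
  have hle : ∀ t : Icc (0 : ℝ≥0) T, (∑' e : Bond V,
      if Function.leftLim (X : ℝ≥0 → V) t = e.1.1 ∧ X t = e.1.2 then (1 : ℝ≥0∞) else 0) ≤
      if Function.leftLim (X : ℝ≥0 → V) t ≠ X t then 1 else 0 := fun t => by
    split_ifs with h
    · rw [tsum_eq_single ⟨(Function.leftLim (X : ℝ≥0 → V) t, X t), h⟩]
      · simp
      · intro e he
        rw [if_neg]
        rintro ⟨h1, h2⟩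
        exact he (Subtype.ext (Prod.ext h1.symm h2.symm))
    · push Not at h
      refine (ENNReal.tsum_eq_zero.2 fun e => if_neg ?_).le
      rintro ⟨h1, h2⟩
      exact e.2 (h1.symm.trans (h.trans h2))
  refine (ENNReal.tsum_le_tsum hle).trans ?_
  rw [ENNReal.tsum_eq_iSup_sum]
  refine iSup_le fun s => ?_
  rw [Finset.sum_boole]
  rw [← Finset.card_map (Function.Embedding.subtype _)]
  refine X.card_jumps_le hT _ fun t ht => ?_
  obtain ⟨t', ht', rfl⟩ := Finset.mem_map.1 ht
  exact ⟨t'.2.2, (Finset.mem_filter.1 ht').2⟩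

/-- The paths that, for all fine grids of `[0,T]`, jump along the bond `e` on some cell. -/
def gridFlowEvent (T : ℝ≥0) (e : Bond V) : Set (PathSpace V) :=
  {X | ∀ᶠ n in atTop, ∃ k < n, X (gridPoint T n k) = e.1.1 ∧ X (gridPoint T n (k + 1)) = e.1.2}

/-- A single jump along `e` is seen by all fine grids. This encloses the event of positive flow
through `e` in one that depends on countably many coordinates. -/
lemma mem_gridFlowEvent (X : PathSpace V) {T : ℝ≥0} (hT : 0 < T) {e : Bond V}
    (h : empFlow T X e ≠ 0) : X ∈ gridFlowEvent T e := by
  classical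
  rw [empFlow, mul_ne_zero_iff] at h
  obtain ⟨t, ht⟩ : ∃ t : Icc (0 : ℝ≥0) T,
      Function.leftLim (X : ℝ≥0 → V) t = e.1.1 ∧ X t = e.1.2 := by
    by_contra! hc
    refine h.2 (ENNReal.tsum_eq_zero.2 fun t => if_neg ?_)
    rintro ⟨h1, h2⟩
    exact hc t h1 h2
  have hpos : 0 < (t : ℝ≥0) := pos_iff_ne_zero.2 fun h0 => e.2 (by
    rw [← ht.1, ← ht.2, h0]; exact X.leftLim_zero)
  change ∀ᶠ n in atTop, _
  filter_upwards [X.eventually_gridPoint hT hpos, eventually_gt_atTop 0] with n hn hn0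
  exact ⟨_, gridCell_lt hT hpos t.2.2 hn0, hn.1.trans ht.1, hn.2.trans ht.2⟩

variable [MeasurableSpace V]

omit [DiscreteTopology V] in
lemma PathSpace.measurable_eval (t : ℝ≥0) : Measurable fun X : PathSpace V => X t :=
  (measurable_pi_apply t).comp (comap_measurable PathSpace.toFun)

variable [Countable V] [BorelSpace V]

lemma measurable_gridJumps (T : ℝ≥0) (n : ℕ) : Measurable (gridJumps T n : PathSpace V → ℝ≥0∞) := by
  classical
  refine Finset.measurable_sum _ fun k _ => Measurable.ite ?_ measurable_const measurable_const
  exact (measurableSet_eq_fun (PathSpace.measurable_eval _) (PathSpace.measurable_eval _)).compl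

lemma measurableSet_gridFlowEvent (T : ℝ≥0) (e : Bond V) : MeasurableSet (gridFlowEvent T e) := by
  have : gridFlowEvent T e = ⋃ N : ℕ, ⋂ n : ℕ, ⋂ _ : N ≤ n, ⋃ k : ℕ, ⋃ _ : k < n,
      {X : PathSpace V | X (gridPoint T n k) = e.1.1} ∩
        {X : PathSpace V | X (gridPoint T n (k + 1)) = e.1.2} := by
    ext X
    simp only [gridFlowEvent, eventually_atTop, mem_iUnion, mem_iInter, mem_inter_iff,
      mem_ofPred_eq, exists_prop]
  rw [this]
  refine .iUnion fun N => .iInter fun n => .iInter fun _ => .iUnion fun k => .iUnion fun _ => ?_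
  exact (PathSpace.measurable_eval _ (measurableSet_singleton _)).inter
    (PathSpace.measurable_eval _ (measurableSet_singleton _))

omit [Countable V] in
/-- Joint measurability of the coordinates of a path in the path and in time. -/
lemma PathSpace.measurable_uncurry :
    Measurable fun p : PathSpace V × ℝ => p.1 p.2.toNNReal := by
  -- These times take countably many values and approach `t.toNNReal` from the right, so right
  -- continuity gives pointwise convergence of the approximations.
  set q : ℕ → ℝ → ℝ≥0 := fun n t => ((⌊t * (n + 1)⌋₊ + 1 : ℕ) : ℝ≥0) / ((n + 1 : ℕ) : ℝ≥0) with hq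
  have hqm : ∀ n, Measurable fun p : PathSpace V × ℝ => p.1 (q n p.2) := fun n => by
    have h1 : Measurable fun p : PathSpace V × ℕ =>
        p.1 (((p.2 + 1 : ℕ) : ℝ≥0) / ((n + 1 : ℕ) : ℝ≥0)) :=
      measurable_from_prod_countable_left fun m =>
        PathSpace.measurable_eval (((m + 1 : ℕ) : ℝ≥0) / ((n + 1 : ℕ) : ℝ≥0))
    have h2 : Measurable fun p : PathSpace V × ℝ => (p.1, ⌊p.2 * (n + 1)⌋₊) :=
      measurable_fst.prodMk (Nat.measurable_floor.comp (by fun_prop))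
    exact h1.comp h2
  refine measurable_of_tendsto_metrizable hqm (tendsto_pi_nhds.2 fun p => ?_)
  obtain ⟨X, t⟩ := p
  have hlim : Tendsto (fun n => q n t) atTop (𝓝[≥] t.toNNReal) := by
    have hlow : ∀ n, t.toNNReal ≤ q n t := fun n => by
      rw [Real.toNNReal_le_iff_le_coe, hq]
      push_cast
      rw [le_div_iff₀ (by positivity)]
      exact (Nat.lt_floor_add_one _).le
    have hup : ∀ n : ℕ, q n t ≤ t.toNNReal + 1 / ((n : ℝ≥0) + 1) := fun n => by
      rw [hq]
      push_cast
      rw [div_le_iff₀ (by positivity), add_mul, one_div, inv_mul_cancel₀ (by positivity)]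
      gcongr
      rw [← NNReal.coe_le_coe]
      push_cast
      rcases le_total t 0 with ht | ht
      · rw [Nat.floor_of_nonpos (mul_nonpos_of_nonpos_of_nonneg ht (by positivity))]
        simp only [CharP.cast_eq_zero]
        positivity
      · rw [Real.coe_toNNReal _ ht]
        exact Nat.floor_le (by positivity)
    have h0 : Tendsto (fun n : ℕ => t.toNNReal + 1 / ((n : ℝ≥0) + 1)) atTop (𝓝 t.toNNReal) := by
      have := tendsto_one_div_add_atTop_nhds_zero_nat (𝕜 := ℝ)
      have h : Tendsto (fun n : ℕ => 1 / ((n : ℝ≥0) + 1)) atTop (𝓝 0) := by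
        rw [← NNReal.tendsto_coe]
        simpa using this
      simpa using tendsto_const_nhds.add h
    exact tendsto_nhdsWithin_iff.2 ⟨tendsto_of_tendsto_of_tendsto_of_le_of_le tendsto_const_nhds h0
      hlow hup, Eventually.of_forall hlow⟩
  exact (X.cadlag t.toNNReal).1.tendsto.comp hlim

/-- The additive functional `∫_0^T f(X_t) dt`. -/
def PathSpace.integral (f : V → ℝ≥0) (T : ℝ≥0) (X : PathSpace V) : ℝ≥0∞ :=
  ∫⁻ t in Icc (0 : ℝ) T, f (X t.toNNReal)

lemma PathSpace.measurable_integral (f : V → ℝ≥0) (T : ℝ≥0) :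
    Measurable (PathSpace.integral f T) := by
  have hf : Measurable fun y => (f y : ℝ≥0∞) := measurable_of_countable _
  exact (hf.comp PathSpace.measurable_uncurry).lintegral_prod_right'

lemma lintegral_empMeasure (f : V → ℝ≥0) {T : ℝ≥0} (hT : 0 < T) (X : PathSpace V) :
    ∫⁻ y, f y ∂(empMeasure T X : Measure V) = (T : ℝ≥0∞)⁻¹ * PathSpace.integral f T X := by
  have hX : Measurable fun t : ℝ => X t.toNNReal := X.measurable.comp measurable_real_toNNReal
  have hμ : (empMeasure T X : Measure V) = (T : ℝ≥0∞)⁻¹ • (volume.restrict (Icc (0 : ℝ) T)).map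
      (fun t => X t.toNNReal) :=
    congrArg (fun μ : ProbabilityMeasure V => (μ : Measure V)) (dif_pos hT)
  rw [hμ, lintegral_smul_measure, lintegral_map (measurable_of_countable _) hX]
  rfl

end Paths

/-! ### Almost sure regularity of samples -/

section Regular

variable {V : Type*}

/-- The samples whose path can be read off from its visits: almost every sample is of this kind. -/
structure Rates.Regular (r : Rates V) (x : V) (ω : Sample V) : Prop where
  noExplosion : r.NoExplosion ω
  start : (ω 0).1 = x
  pos : ∀ i, 0 < (ω i).2
  jump : ∀ i, r.jump (ω i).1 (ω (i + 1)).1 ≠ 0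

lemma Rates.Regular.hold_pos {r : Rates V} {x : V} {ω : Sample V} (h : r.Regular x ω) (i : ℕ) :
    0 < r.hold (ω i) :=
  ENNReal.div_pos (ENNReal.ofReal_pos.2 (h.pos i)).ne' ENNReal.coe_ne_top

lemma Rates.rate_pos_of_jump (r : Rates V) {y z : V} (h : r.jump y z ≠ 0) (hyz : y ≠ z) :
    0 < r.rate y z := by
  by_cases he : r.exit y = 0
  · rw [Rates.jump, dif_pos he, PMF.pure_apply, if_neg hyz.symm] at h
    exact absurd rfl h
  · rw [r.jump_apply he] at h
    refine pos_iff_ne_zero.2 fun h0 => h ?_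
    rw [h0]; simp

variable [Countable V] [MeasurableSpace V] [MeasurableSingletonClass V]

/-- An event that has probability zero for each step does not occur along the sample. -/
lemma Rates.ae_notMem_of_step (r : Rates V) (x : V) (n : ℕ) {S : V → Set (V × ℝ)}
    (hS : ∀ y, MeasurableSet (S y)) (h0 : ∀ y, r.step y (S y) = 0) :
    ∀ᵐ ω ∂r.sampleLaw x, ω (n + 1) ∉ S (ω n).1 := by
  have hA : MeasurableSet {q : Sample V × (V × ℝ) | q.2 ∈ S (q.1 n).1} := by
    have : {q : Sample V × (V × ℝ) | q.2 ∈ S (q.1 n).1} =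
        ⋃ y, {q : Sample V × (V × ℝ) | (q.1 n).1 = y} ∩ {q | q.2 ∈ S y} := by
      ext q; simp
    rw [this]
    refine .iUnion fun y => .inter ?_ (measurable_snd (hS y))
    exact (by fun_prop : Measurable fun q : Sample V × (V × ℝ) => (q.1 n).1)
      (measurableSet_singleton y)
  set F : Sample V → V × ℝ → ℝ≥0∞ := fun ω => (S (ω n).1).indicator 1 with hF
  have hFm : Measurable (Function.uncurry F) := by
    have : Function.uncurry F = {q : Sample V × (V × ℝ) | q.2 ∈ S (q.1 n).1}.indicator 1 := by
      ext q; simp [F, Function.uncurry, Set.indicator]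
    rw [this]
    exact measurable_one.indicator hA
  -- The expected indicator of the bad event is the mean of its one-step probabilities, all zero.
  have key := r.lintegral_step x n F hFm fun ω ω' h => by simp only [hF]; rw [h n le_rfl]
  have hz : ∀ ω : Sample V, ∫⁻ z, F ω z ∂r.step (ω n).1 = 0 := fun ω => by
    simp only [hF]
    rw [lintegral_indicator_one (hS _), h0]
  simp_rw [hz, lintegral_zero] at key
  have hFm' : Measurable fun ω : Sample V => F ω (ω (n + 1)) :=
    hFm.comp (measurable_id.prodMk (measurable_pi_apply (n + 1)))
  rw [lintegral_eq_zero_iff hFm'] at key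
  filter_upwards [key] with ω hω hmem
  simp [hF, hmem] at hω

lemma Rates.step_irregular_eq_zero (r : Rates V) (y : V) :
    r.step y {z | ¬ (0 < z.2 ∧ r.jump y z.1 ≠ 0)} = 0 := by
  rw [r.step_apply, ← ae_iff]
  have h1 : ∀ᵐ z ∂(r.jump y).toMeasure, r.jump y z ≠ 0 := by
    rw [ae_iff, PMF.toMeasure_apply_eq_zero_iff _ (Set.to_countable _).measurableSet]
    exact Set.disjoint_left.2 fun z hz hz' => hz' hz
  filter_upwards [Measure.quasiMeasurePreserving_fst.ae h1,
    Measure.quasiMeasurePreserving_snd.ae (ae_pos_expMeasure one_pos)] with z hz1 hz2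
  exact ⟨hz2, hz1⟩

lemma Rates.ae_regular (r : Rates V) (hr : r.NonExplosive) (x : V) :
    ∀ᵐ ω ∂r.sampleLaw x, r.Regular x ω := by
  have h0 : ∀ᵐ ω ∂r.sampleLaw x, (ω 0).1 = x ∧ 0 < (ω 0).2 := by
    have h : ∀ᵐ p ∂(r.sampleLaw x).map (fun ω => ω 0), p.1 = x ∧ 0 < p.2 := by
      have hm : MeasurableSet {p : V × ℝ | p.1 = x ∧ 0 < p.2} :=
        (measurable_fst (measurableSet_singleton x)).inter
          (measurableSet_lt measurable_const measurable_snd)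
      rw [r.sampleLaw_map_zero, Measure.dirac_prod,
        ae_map_iff measurable_prodMk_left.aemeasurable hm]
      filter_upwards [ae_pos_expMeasure one_pos] with t ht
      exact ⟨rfl, ht⟩
    exact ae_of_ae_map (measurable_pi_apply 0).aemeasurable h
  have hstep : ∀ᵐ ω ∂r.sampleLaw x, ∀ n,
      ω (n + 1) ∉ {z : V × ℝ | ¬ (0 < z.2 ∧ r.jump (ω n).1 z.1 ≠ 0)} := by
    refine ae_all_iff.2 fun n => r.ae_notMem_of_step x n
      (S := fun y => {z | ¬ (0 < z.2 ∧ r.jump y z.1 ≠ 0)}) (fun y => ?_) r.step_irregular_eq_zero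
    exact ((measurableSet_lt measurable_const measurable_snd).inter
      (measurable_comp_fst (r.jump y) (measurableSet_singleton 0)).compl).compl
  filter_upwards [hr x, h0, hstep] with ω h1 h2 h3
  simp only [not_not] at h3
  exact ⟨h1, h2.1, fun i => i.casesOn h2.2 fun n => (h3 n).1, fun i => (h3 i).2⟩

end Regular

/-! ### Path functionals in terms of samples -/

section SamplePath

variable {V : Type*} [TopologicalSpace V] {r : Rates V} {ω : Sample V}

lemma Rates.path_apply (hω : r.NoExplosion ω) {t : ℝ≥0} {n : ℕ} (h₁ : r.jumpTime ω n ≤ t)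
    (h₂ : t < r.jumpTime ω (n + 1)) : r.path ω t = (ω n).1 := by
  rw [Rates.path, dif_pos hω]
  exact r.stateAt_eq ω hω h₁ h₂

omit [TopologicalSpace V] in
lemma Rates.index_le {s t : ℝ≥0} (hst : s ≤ t) {m n : ℕ} (h₁ : r.jumpTime ω m ≤ s)
    (h₂ : t < r.jumpTime ω (n + 1)) : m ≤ n := by
  by_contra! h
  exact absurd ((h₁.trans (ENNReal.coe_le_coe.2 hst)).trans_lt h₂)
    (not_lt.2 (r.jumpTime_mono ω h))

open Classical in
/-- Along an increasing sequence of times at most as many changes as jumps are seen. -/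
lemma Rates.sum_changes_le (hω : r.NoExplosion ω) {s : ℕ → ℝ≥0} (hs : Monotone s) (m : ℕ) :
    ∀ {n : ℕ}, r.jumpTime ω n ≤ s m → s m < r.jumpTime ω (n + 1) →
      (∑ k ∈ Finset.range m, if r.path ω (s k) ≠ r.path ω (s (k + 1)) then (1 : ℝ≥0∞) else 0) ≤
        n := by
  induction m with
  | zero => simp
  | succ m ih =>
    intro n h₁ h₂
    obtain ⟨k, hk₁, hk₂⟩ := r.exists_jumpTime ω hω (s m)
    have hkn : k ≤ n := Rates.index_le (hs m.le_succ) hk₁ h₂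
    rw [Finset.sum_range_succ]
    -- Either no jump separates the last two times and the state is the same, or the jump count
    -- grows by at least one and absorbs the possible change.
    rcases hkn.eq_or_lt with rfl | hlt
    · rw [Rates.path_apply hω hk₁ hk₂, Rates.path_apply hω h₁ h₂]
      simpa using ih hk₁ hk₂
    · calc _ ≤ (k : ℝ≥0∞) + 1 := by
            gcongr
            · exact ih hk₁ hk₂
            · split_ifs <;> simp
        _ ≤ n := by exact_mod_cast hlt

lemma Rates.gridJumps_path_le (hω : r.NoExplosion ω) {T : ℝ≥0} {n : ℕ}
    (h₁ : r.jumpTime ω n ≤ T) (h₂ : T < r.jumpTime ω (n + 1)) {m : ℕ} (hm : 0 < m) :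
    gridJumps T m (r.path ω) ≤ n :=
  Rates.sum_changes_le hω (gridPoint_mono T m) m (by rwa [gridPoint_self T hm])
    (by rwa [gridPoint_self T hm])

/-- A regular sample does not jump along bonds of rate zero. -/
lemma Rates.Regular.notMem_gridFlowEvent {x : V} (hω : r.Regular x ω) (T : ℝ≥0) {e : Bond V}
    (he : e ∉ r.edges) : r.path ω ∉ gridFlowEvent T e := by
  obtain ⟨N, hN₁, hN₂⟩ := r.exists_jumpTime ω hω.noExplosion T
  intro hmem
  -- A mesh below all holding times of the visits up to `T` leaves no room for two jumps in one
  -- cell. The change seen on the cell is then a single step of the jump chain, which has positive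
  -- rate.
  have hmesh : ∀ᶠ n : ℕ in atTop, ∀ i ∈ Finset.range (N + 1),
      ((T / n : ℝ≥0) : ℝ≥0∞) < r.hold (ω i) := by
    rw [Filter.eventually_all_finset]
    intro i _
    exact (ENNReal.tendsto_coe.2 (tendsto_mesh T)).eventually
      (gt_mem_nhds (by simpa using hω.hold_pos i))
  change ∀ᶠ n in atTop, _ at hmem
  obtain ⟨n, hn, ⟨k, hk, hy, hz⟩, hn0⟩ :=
    (hmesh.and (hmem.and (eventually_gt_atTop 0))).exists
  set p := gridPoint T n k
  have hpq : gridPoint T n (k + 1) = p + T / n := gridPoint_succ T n k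
  set q := gridPoint T n (k + 1)
  have hqT : q ≤ T := (gridPoint_mono T n hk).trans_eq (gridPoint_self T hn0)
  have hle : p ≤ q := gridPoint_mono T n k.le_succ
  obtain ⟨i, hi₁, hi₂⟩ := r.exists_jumpTime ω hω.noExplosion p
  obtain ⟨j, hj₁, hj₂⟩ := r.exists_jumpTime ω hω.noExplosion q
  have hij : i ≤ j := Rates.index_le hle hi₁ hj₂
  have hjN : j ≤ N := Rates.index_le hqT hj₁ hN₂
  rw [Rates.path_apply hω.noExplosion hi₁ hi₂] at hy
  rw [Rates.path_apply hω.noExplosion hj₁ hj₂] at hz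
  have hne : i ≠ j := fun h => e.2 (by rw [← hy, ← hz, h])
  have hj : j = i + 1 := by
    by_contra hc
    have h2 : i + 2 ≤ j := by omega
    have h3 : r.jumpTime ω (i + 2) ≤ q := (r.jumpTime_mono ω h2).trans hj₁
    rw [r.jumpTime_succ, hpq, ENNReal.coe_add] at h3
    exact absurd h3 (not_le.2 (ENNReal.add_lt_add hi₂
      (hn (i + 1) (Finset.mem_range.2 (by omega)))))
  subst hj
  refine he (?_ : 0 < r.rate e.1.1 e.1.2)
  have hjump := hω.jump i
  rw [hy, hz] at hjump
  exact r.rate_pos_of_jump hjump e.2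

/-- The path is dominated by a sum of indicators of closed visit intervals. Counting common end
points twice is harmless, since only the upper bound is needed. -/
lemma Rates.integral_path_le (hω : r.NoExplosion ω) (f : V → ℝ≥0) {T : ℝ≥0} {n : ℕ}
    (h₁ : r.jumpTime ω n ≤ T) (h₂ : T < r.jumpTime ω (n + 1)) :
    PathSpace.integral f T (r.path ω) ≤
      ENNReal.ofReal (r.occupation (fun y => f y) T n ω) := by
  have hfin : ∀ i ≤ n, r.jumpTime ω i ≠ ∞ := fun i hi =>
    (((r.jumpTime_mono ω hi).trans h₁).trans_lt ENNReal.coe_lt_top).ne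
  set S : ℝ → ℝ≥0∞ := fun t => ∑ i ∈ Finset.range n,
    (Icc (r.jumpTime ω i).toReal (r.jumpTime ω (i + 1)).toReal).indicator
      (fun _ => (f (ω i).1 : ℝ≥0∞)) t +
    (Icc (r.jumpTime ω n).toReal T).indicator (fun _ => (f (ω n).1 : ℝ≥0∞)) t with hS
  have hle : ∀ t ∈ Icc (0 : ℝ) T, (f (r.path ω t.toNNReal) : ℝ≥0∞) ≤ S t := by
    intro t ht
    obtain ⟨k, hk₁, hk₂⟩ := r.exists_jumpTime ω hω t.toNNReal
    have hkn : k ≤ n := Rates.index_le (Real.toNNReal_le_iff_le_coe.2 ht.2) hk₁ h₂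
    have hkt : (r.jumpTime ω k).toReal ≤ t := by
      rw [← Real.coe_toNNReal t ht.1]
      exact ENNReal.toReal_mono ENNReal.coe_ne_top hk₁
    rw [Rates.path_apply hω hk₁ hk₂]
    rcases hkn.eq_or_lt with rfl | hlt
    · refine le_add_left ?_
      rw [indicator_of_mem (mem_Icc.2 ⟨hkt, ht.2⟩)]
    · refine le_add_right ?_
      have hkt' : t ≤ (r.jumpTime ω (k + 1)).toReal := by
        rw [← Real.coe_toNNReal t ht.1]
        exact ENNReal.toReal_mono (hfin _ hlt) hk₂.le
      refine le_trans ?_ (Finset.single_le_sum (fun _ _ => zero_le) (Finset.mem_range.2 hlt))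
      rw [indicator_of_mem (mem_Icc.2 ⟨hkt, hkt'⟩)]
  have hm : ∀ (s : Set ℝ) (c : ℝ≥0∞), MeasurableSet s → Measurable (s.indicator fun _ => c) :=
    fun s c hs => measurable_const.indicator hs
  have hSm : Measurable S := (Finset.measurable_sum _ fun i _ => hm _ _ measurableSet_Icc).add
    (hm _ _ measurableSet_Icc)
  refine (setLIntegral_mono hSm hle).trans ((setLIntegral_le_lintegral _ _).trans ?_)
  have hT : ∫⁻ t, S t = ∑ i ∈ Finset.range n, (f (ω i).1 : ℝ≥0∞) *
      ENNReal.ofReal (r.hold (ω i)).toReal +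
      (f (ω n).1 : ℝ≥0∞) * ENNReal.ofReal ((T : ℝ≥0∞) - r.jumpTime ω n).toReal := by
    rw [hS, lintegral_add_right _ (hm _ _ measurableSet_Icc),
      lintegral_finsetSum _ fun i _ => hm _ _ measurableSet_Icc]
    simp only [lintegral_indicator measurableSet_Icc, lintegral_const,
      Measure.restrict_apply MeasurableSet.univ, univ_inter, Real.volume_Icc]
    congr 1
    · refine Finset.sum_congr rfl fun i hi => ?_
      have hi' := Finset.mem_range.1 hi
      rw [r.jumpTime_succ, ENNReal.toReal_add (hfin i hi'.le) (r.hold_ne_top h₁ hi'),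
        add_sub_cancel_left]
    · rw [ENNReal.toReal_sub_of_le h₁ ENNReal.coe_ne_top, ENNReal.coe_toReal]
  rw [hT, Rates.occupation, ENNReal.ofReal_add (by positivity) (by positivity),
    ENNReal.ofReal_sum_of_nonneg fun i _ => by positivity]
  simp [ENNReal.ofReal_mul]

end SamplePath

/-! ### Compact sets -/

section MeasureCompact

variable {V : Type*} [Countable V] [TopologicalSpace V] [DiscreteTopology V]
  [MeasurableSpace V] [BorelSpace V]

/-- A function with finite sublevel sets has relatively compact sublevel sets of its integral. -/
lemma isCompact_closure_lintegral_le {f : V → ℝ≥0} (hf : ∀ a : ℝ≥0, {y | f y ≤ a}.Finite)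
    (a : ℝ≥0) :
    IsCompact (closure {μ : ProbabilityMeasure V | ∫⁻ y, f y ∂(μ : Measure V) ≤ a}) := by
  -- Prokhorov's theorem reduces this to tightness. The finite set `{f ≤ m}` carries all but mass `a
  -- / m`, by Markov's inequality.
  refine isCompact_closure_of_isTightMeasureSet ?_
  rw [isTightMeasureSet_iff_exists_isCompact_measure_compl_le]
  intro ε hε
  obtain ⟨m, hm0, hm⟩ : ∃ m : ℝ≥0, 0 < m ∧ (a : ℝ≥0∞) / m ≤ ε := by
    rcases eq_or_ne ε ∞ with rfl | hε'
    · exact ⟨1, one_pos, le_top⟩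
    lift ε to ℝ≥0 using hε'
    have hε0 : 0 < ε := by exact_mod_cast hε
    refine ⟨(a + 1) / ε, by positivity, ENNReal.div_le_of_le_mul ?_⟩
    rw [← ENNReal.coe_mul, mul_div_cancel₀ _ hε0.ne']
    exact_mod_cast le_self_add
  refine ⟨{y | f y ≤ m}, (hf m).isCompact, ?_⟩
  rintro _ ⟨μ, hμ, rfl⟩
  have hsub : {y | f y ≤ m}ᶜ ⊆ {y | (m : ℝ≥0∞) ≤ f y} := fun y hy => by
    simp only [mem_compl_iff, mem_ofPred_eq, not_le] at hy
    exact ENNReal.coe_le_coe.2 hy.le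
  refine (measure_mono hsub).trans (le_trans ?_ hm)
  refine (meas_ge_le_lintegral_div (measurable_of_countable _).aemeasurable
    (by exact_mod_cast hm0.ne') ENNReal.coe_ne_top).trans ?_
  gcongr
  exact hμ

end MeasureCompact

/-! ### Flows of bounded mass in the bounded weak* topology -/

section FlowCompact

variable {V : Type*}

lemma l1_norm_eq (r : Rates V) (Q : r.L1) : ‖Q‖ = ∑' e, |Q e| := by
  rw [lp.norm_eq_tsum_rpow (by simp)]
  simp

variable [TopologicalSpace V] [DiscreteTopology V]

/-- The flows of mass at most `a`, as functions on the edges. -/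
def massLe (E : Type*) (a : ℝ) : Set (E → ℝ) :=
  {q | (∀ e, 0 ≤ q e) ∧ ∀ s : Finset E, ∑ e ∈ s, q e ≤ a}

/-- Testing the mass on finite sets of edges makes the constraint closed for pointwise convergence.
Tychonoff's theorem for `[0,a]^E` then applies. -/
lemma isCompact_massLe (E : Type*) (a : ℝ) : IsCompact (massLe E a) := by
  have hcl : IsClosed (massLe E a) := by
    have : massLe E a = (⋂ e, {q | 0 ≤ q e}) ∩ ⋂ s : Finset E, {q | ∑ e ∈ s, q e ≤ a} := by
      ext q; simp [massLe]
    rw [this]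
    exact (isClosed_iInter fun e => isClosed_le continuous_const (continuous_apply e)).inter
      (isClosed_iInter fun s => isClosed_le
        (continuous_finsetSum _ fun e _ => continuous_apply e) continuous_const)
  refine (isCompact_univ_pi fun _ : E => isCompact_Icc (a := 0) (b := a)).of_isClosed_subset hcl ?_
  intro q hq e _
  exact ⟨hq.1 e, by simpa using hq.2 {e}⟩

lemma summable_of_mem_massLe {E : Type*} {a : ℝ} {q : E → ℝ} (hq : q ∈ massLe E a) : Summable q :=
  summable_of_sum_le hq.1 hq.2

lemma tsum_le_of_mem_massLe {E : Type*} {a : ℝ} {q : E → ℝ} (hq : q ∈ massLe E a) : ∑' e, q e ≤ a :=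
  (summable_of_mem_massLe hq).tsum_le_of_sum_le hq.2

/-- Functions vanishing at infinity are continuous on flows of bounded mass. -/
lemma continuous_tsum_massLe {E : Type*} [TopologicalSpace E] [DiscreteTopology E] (a : ℝ)
    (f : C₀(E, ℝ)) : Continuous fun q : massLe E a => ∑' e, q.1 e * f e := by
  refine continuous_of_uniform_approx_of_continuous fun u hu => ?_
  obtain ⟨ε, hε, hεu⟩ := Metric.mem_uniformity_dist.1 hu
  -- Outside the finite set `{δ ≤ |f|}` a flow of mass at most `a` contributes at most `a * δ < ε`,
  -- so finite sums approximate uniformly.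
  set δ : ℝ := ε / (2 * (|a| + 1)) with hδ
  have hδ0 : 0 < δ := by positivity
  have hfin : {e | δ ≤ |f e|}.Finite := by
    have h : ∀ᶠ e in cocompact E, |f e| < δ := by
      have := (f.zero_at_infty').eventually (Metric.ball_mem_nhds 0 hδ0)
      filter_upwards [this] with e he
      simpa using he
    rw [cocompact_eq_cofinite] at h
    refine h.subset fun e he => ?_
    simpa using he
  refine ⟨fun q => ∑ e ∈ hfin.toFinset, q.1 e * f e, ?_, fun q => hεu ?_⟩
  · exact continuous_finsetSum _ fun e _ =>
      ((continuous_apply e).comp continuous_subtype_val).mul continuous_const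
  have hq := q.2
  have hsum := summable_of_mem_massLe hq
  have hb : ∀ e, |f e| ≤ ‖f.toBCF‖ := fun e => f.toBCF.norm_coe_le_norm e
  have habs : ∀ e, |q.1 e * f e| = q.1 e * |f e| := fun e => by
    rw [abs_mul, abs_of_nonneg (hq.1 e)]
  have hs : Summable fun e => q.1 e * f e := by
    refine Summable.of_norm_bounded (hsum.mul_right ‖f.toBCF‖) fun e => ?_
    rw [Real.norm_eq_abs, habs]
    exact mul_le_mul_of_nonneg_left (hb e) (hq.1 e)
  rw [Real.dist_eq, ← hs.sum_add_tsum_subtype_compl hfin.toFinset, add_sub_cancel_left]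
  have hle : ∀ e : {e // e ∉ hfin.toFinset}, ‖q.1 e * f e‖ ≤ q.1 e * δ := fun e => by
    rw [Real.norm_eq_abs, habs]
    have he : |f e| < δ := by simpa using e.2
    exact mul_le_mul_of_nonneg_left he.le (hq.1 e)
  have hsc : Summable fun e : {e // e ∉ hfin.toFinset} => q.1 e :=
    hsum.subtype {e | e ∉ hfin.toFinset}
  have h0 : (0 : ℝ) ≤ a := by simpa using hq.2 ∅
  calc |∑' e : {e // e ∉ hfin.toFinset}, q.1 e * f e|
      ≤ ∑' e : {e // e ∉ hfin.toFinset}, q.1 e * δ :=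
        tsum_of_norm_bounded (hsc.mul_right δ).hasSum hle
    _ = (∑' e : {e // e ∉ hfin.toFinset}, q.1 e) * δ := tsum_mul_right
    _ ≤ a * δ := by
        gcongr
        exact (hsum.tsum_subtype_le _ {e | e ∉ hfin.toFinset} hq.1).trans (tsum_le_of_mem_massLe hq)
    _ < ε := by
        rw [hδ, abs_of_nonneg h0, ← mul_div_assoc, div_lt_iff₀ (by positivity)]
        nlinarith

/-- The element of `L¹(E)` given by a function of finite mass. -/
def massLe.toL1 (r : Rates V) {a : ℝ} (q : massLe r.edges a) : r.L1 :=
  ⟨q.1, memℓp_gen (by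
    have := summable_of_mem_massLe q.2
    simpa [abs_of_nonneg (q.2.1 _)] using this)⟩

omit [TopologicalSpace V] [DiscreteTopology V] in
lemma massLe.norm_toL1_le (r : Rates V) {a : ℝ} (q : massLe r.edges a) : ‖massLe.toL1 r q‖ ≤ a := by
  rw [l1_norm_eq]
  have : ∀ e, |massLe.toL1 r q e| = q.1 e := fun e => abs_of_nonneg (q.2.1 e)
  simp_rw [this]
  exact tsum_le_of_mem_massLe q.2

/-- The element of `L¹₊(E)` given by a function of finite mass. -/
def massLe.toFlow (r : Rates V) {a : ℝ} (q : massLe r.edges a) : r.FlowSpace :=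
  ⟨massLe.toL1 r q, q.2.1⟩

/-- The map factors through the ball of radius `a` with its weak* topology, whose inclusion is
continuous for the bounded weak* topology by construction. Continuity into the ball is tested
against each function of `C₀(E)`. -/
lemma massLe.continuous_toFlow (r : Rates V) {a : ℝ} (ha : 0 < a) :
    Continuous (massLe.toFlow r : massLe r.edges a → r.FlowSpace) := by
  refine continuous_induced_rng.2 ?_
  set B : Type _ := {Q : r.L1 // ‖Q‖ ≤ a}
  let tB : TopologicalSpace B := TopologicalSpace.induced Subtype.val r.weakStar
  have h1 : @Continuous _ B _ tB fun q : massLe r.edges a =>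
      ⟨massLe.toL1 r q, massLe.norm_toL1_le r q⟩ := by
    refine continuous_induced_rng.2 (continuous_iInf_rng.2 fun f => continuous_induced_rng.2 ?_)
    exact continuous_tsum_massLe a f
  have h2 : @Continuous B r.L1 tB r.boundedWeakStar Subtype.val :=
    continuous_iff_coinduced_le.2 (le_iSup (fun ℓ : Ioi (0 : ℝ) => TopologicalSpace.coinduced
      (Subtype.val : {Q : r.L1 // ‖Q‖ ≤ ℓ} → r.L1)
      (TopologicalSpace.induced Subtype.val r.weakStar)) ⟨a, ha⟩)
  exact @Continuous.comp _ _ _ _ tB r.boundedWeakStar _ _ h2 h1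

lemma isCompact_range_toFlow (r : Rates V) {a : ℝ} (ha : 0 < a) :
    IsCompact (range (massLe.toFlow r : massLe r.edges a → r.FlowSpace)) := by
  have : CompactSpace (massLe r.edges a) := isCompact_iff_compactSpace.1 (isCompact_massLe _ a)
  exact isCompact_range (massLe.continuous_toFlow r ha)

omit [TopologicalSpace V] [DiscreteTopology V] in
lemma mem_extend_range_toFlow (r : Rates V) {a : ℝ} (ha : 0 ≤ a) {Q : Bond V → ℝ≥0∞}
    (hQ : flowNorm Q ≤ ENNReal.ofReal a) (hE : ∀ e ∉ r.edges, Q e = 0) :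
    Q ∈ Rates.FlowSpace.extend r '' range (massLe.toFlow r : massLe r.edges a → r.FlowSpace) := by
  have hfin : ∀ e, Q e ≠ ∞ := fun e =>
    (((ENNReal.le_tsum e).trans hQ).trans_lt ENNReal.ofReal_lt_top).ne
  have hq : (fun e : r.edges => (Q e).toReal) ∈ massLe r.edges a := by
    refine ⟨fun e => ENNReal.toReal_nonneg, fun s => ?_⟩
    rw [← ENNReal.toReal_sum (f := fun e : r.edges => Q e) fun e _ => hfin e]
    refine ENNReal.toReal_le_of_le_ofReal ha ?_
    exact (ENNReal.sum_le_tsum s).trans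
      ((ENNReal.tsum_comp_le_tsum_of_injective Subtype.val_injective Q).trans hQ)
  refine ⟨_, ⟨⟨_, hq⟩, rfl⟩, funext fun e => ?_⟩
  rw [Rates.FlowSpace.extend]
  split_ifs with h
  · exact ENNReal.ofReal_toReal (hfin e)
  · exact (hE e h).symm

end FlowCompact

/-! ### Exponential tails -/

section Tails

lemma expRate_le_of_eventually {Ω : Type*} [MeasurableSpace Ω] {P : Measure Ω} {A : ℝ≥0 → Set Ω}
    {m : ℝ} (h : ∀ᶠ T : ℝ≥0 in atTop, P (A T) ≤ ENNReal.ofReal (Real.exp (-(m * T)))) :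
    expRate P A ≤ ((-m : ℝ) : EReal) := by
  refine limsup_le_of_le (by isBoundedDefault) ?_
  filter_upwards [h, eventually_gt_atTop 0] with T hT hT0
  have hlog : ENNReal.log (P (A T)) ≤ ((-(m * T) : ℝ) : EReal) := by
    refine (ENNReal.log_monotone hT).trans_eq ?_
    rw [ENNReal.log_ofReal_of_pos (Real.exp_pos _), Real.log_exp]
  refine (mul_le_mul_of_nonneg_left hlog (by exact_mod_cast inv_nonneg.2 T.2)).trans_eq ?_
  have hT0' : (T : ℝ) ≠ 0 := by exact_mod_cast hT0.ne'
  rw [← EReal.coe_mul]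
  congr 1
  field_simp

variable {V : Type*} [Countable V] [TopologicalSpace V] [DiscreteTopology V]
  [MeasurableSpace V] [BorelSpace V]

lemma Rates.law_apply (r : Rates V) (x : V) {E : Set (PathSpace V)} (hE : MeasurableSet E) :
    r.law x E = r.sampleLaw x (r.path ⁻¹' E) :=
  Measure.map_apply r.measurable_path hE

/-- Chebyshev's inequality: on `E`, up to a null set, `G` is at least `exp (s - d)`, while its mean
is at most 1. -/
lemma Rates.law_le_exp (r : Rates V) (hr : r.NonExplosive) (x : V) {H : Sample V → ℕ → ℝ} {T : ℝ≥0}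
    {d s : ℝ} {G : Sample V → ℝ≥0∞} (hG : Measurable G) (hG1 : ∫⁻ ω, G ω ∂r.sampleLaw x ≤ 1)
    (hGH : ∀ ω n, (ω 0).1 = x → r.jumpTime ω n ≤ T → T < r.jumpTime ω (n + 1) →
      ENNReal.ofReal (Real.exp (H ω n - d)) ≤ G ω)
    {E : Set (PathSpace V)} (hE : MeasurableSet E)
    (hs : ∀ ω n, r.Regular x ω → r.jumpTime ω n ≤ T → T < r.jumpTime ω (n + 1) →
      r.path ω ∈ E → s ≤ H ω n) :
    r.law x E ≤ ENNReal.ofReal (Real.exp (d - s)) := by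
  have hsub : ∀ᵐ ω ∂r.sampleLaw x, ω ∈ r.path ⁻¹' E →
      ω ∈ {ω | ENNReal.ofReal (Real.exp (s - d)) ≤ G ω} := by
    filter_upwards [r.ae_regular hr x] with ω hω hmem
    obtain ⟨n, h₁, h₂⟩ := r.exists_jumpTime ω hω.noExplosion T
    refine le_trans (ENNReal.ofReal_le_ofReal (Real.exp_le_exp.2 ?_)) (hGH ω n hω.start h₁ h₂)
    linarith [hs ω n hω h₁ h₂ hmem]
  rw [r.law_apply x hE]
  refine (measure_mono_ae hsub).trans ((meas_ge_le_lintegral_div hG.aemeasurable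
    (ENNReal.ofReal_pos.2 (Real.exp_pos _)).ne' ENNReal.ofReal_ne_top).trans ?_)
  refine (ENNReal.div_le_div_right hG1 _).trans_eq ?_
  rw [one_div, ← ENNReal.ofReal_inv_of_pos (Real.exp_pos _), ← Real.exp_neg, neg_sub]

/-- There are countably many bonds, and regular samples avoid the grid event of each bond outside
`E`. -/
lemma Rates.law_off_edges (r : Rates V) (hr : r.NonExplosive) (x : V) {T : ℝ≥0} (hT : 0 < T) :
    r.law x {X | ∃ e ∉ r.edges, empFlow T X e ≠ 0} = 0 := by
  have hsub : {X : PathSpace V | ∃ e ∉ r.edges, empFlow T X e ≠ 0} ⊆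
      ⋃ e : Bond V, ⋃ _ : e ∉ r.edges, gridFlowEvent T e := by
    rintro X ⟨e, he, hX⟩
    exact mem_iUnion₂.2 ⟨e, he, mem_gridFlowEvent X hT hX⟩
  refine measure_mono_null hsub (measure_iUnion_null fun e => measure_iUnion_null fun he => ?_)
  rw [r.law_apply x (measurableSet_gridFlowEvent T e)]
  refine measure_mono_null ?_ (ae_iff.1 (r.ae_regular hr x))
  exact fun ω hω hreg => hreg.notMem_gridFlowEvent T he hω

/-- Exponential tails of an additive functional and of the mass of the empirical flow. -/
theorem Rates.exists_exponential_tails (r : Rates V) (hr : r.NonExplosive)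
    (hC : r.CompactnessCondition) (x : V) :
    ∃ (f : V → ℝ≥0) (a : ℕ → ℝ≥0) (A : ℕ → ℝ), (∀ a : ℝ≥0, {y | f y ≤ a}.Finite) ∧
      StrictMono A ∧ Tendsto A atTop atTop ∧ (∀ ℓ, 0 < A ℓ) ∧
      ∀ ℓ : ℕ, (∀ᶠ T : ℝ≥0 in atTop, r.law x {X | ((a ℓ * T : ℝ≥0) : ℝ≥0∞) <
          PathSpace.integral f T X} ≤ ENNReal.ofReal (Real.exp (-((ℓ : ℝ) * T)))) ∧
        ∀ᶠ T : ℝ≥0 in atTop, r.law x {X | ENNReal.ofReal (A ℓ) < flowNorm (empFlow T X)} ≤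
          ENNReal.ofReal (Real.exp (-((ℓ : ℝ) * T))) := by
  obtain ⟨f, σ, lam, b, κ, hσ, hlam, hf, hbound⟩ := r.exists_exponential_bound hC x
  -- In the level `ℓ + 1 + |b|`, the term `|b|` absorbs the growth `b * T` and the extra `1` absorbs
  -- `κ` once `T ≥ κ`. Dividing by `σ` or `lam` gives the thresholds for the integral and for the
  -- flow.
  have htail : ∀ (ℓ : ℕ) {T : ℝ≥0}, κ ≤ T → ENNReal.ofReal (Real.exp (b * T + κ -
      (ℓ + 1 + |b|) * T)) ≤ ENNReal.ofReal (Real.exp (-((ℓ : ℝ) * T))) := fun ℓ T hT => by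
    refine ENNReal.ofReal_le_ofReal (Real.exp_le_exp.2 ?_)
    have : b * T ≤ |b| * T := mul_le_mul_of_nonneg_right (le_abs_self b) T.2
    linarith
  have hκ : ∀ᶠ T : ℝ≥0 in atTop, κ ≤ T := by
    filter_upwards [eventually_ge_atTop κ.toNNReal] with T hT
    exact Real.toNNReal_le_iff_le_coe.1 hT
  have hocc : ∀ T n ω, 0 ≤ r.occupation (fun y => (f y : ℝ)) T n ω :=
    r.occupation_nonneg fun y => (f y).2
  have hA : StrictMono fun ℓ : ℕ => ((ℓ : ℝ) + 1 + |b|) / lam := fun ℓ ℓ' h => by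
    dsimp only
    gcongr
  refine ⟨f, fun ℓ => ((ℓ + 1 + |b|) / σ).toNNReal, fun ℓ => (ℓ + 1 + |b|) / lam, hf, hA, ?_,
    fun ℓ => by positivity, fun ℓ => ⟨?_, ?_⟩⟩
  · refine Tendsto.atTop_div_const hlam ?_
    exact tendsto_atTop_add_const_right _ _
      (tendsto_atTop_add_const_right _ _ tendsto_natCast_atTop_atTop)
  · filter_upwards [hκ] with T hT
    obtain ⟨G, hGm, hG1, hG⟩ := hbound T
    refine (r.law_le_exp hr x (T := T) (H := fun ω n => lam * n + σ * r.occupation (fun y => f y) T n ω)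
      hGm hG1 (fun ω n h0 h₁ h₂ => ?_)
      (measurableSet_lt measurable_const (PathSpace.measurable_integral f T))
      fun ω n hω h₁ h₂ hmem => ?_).trans (htail ℓ hT)
    · rw [← sub_sub]
      exact hG ω n h0 h₁ h₂
    · have h := lt_of_lt_of_le hmem (Rates.integral_path_le hω.noExplosion f h₁ h₂)
      rw [← ENNReal.ofReal_coe_nnreal, ENNReal.ofReal_lt_ofReal_iff_of_nonneg (NNReal.coe_nonneg _),
        NNReal.coe_mul, Real.coe_toNNReal _ (by positivity), div_mul_eq_mul_div,
        div_lt_iff₀ hσ] at h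
      have : 0 ≤ lam * n := by positivity
      linarith
  · filter_upwards [hκ, eventually_gt_atTop 0] with T hT hT0
    obtain ⟨G, hGm, hG1, hG⟩ := hbound T
    -- The event is enlarged to a measurable one in terms of grid counts, as `Rates.law_le_exp`
    -- requires.
    have hsub : {X : PathSpace V | ENNReal.ofReal ((ℓ + 1 + |b|) / lam) < flowNorm (empFlow T X)} ⊆
        {X | ENNReal.ofReal ((ℓ + 1 + |b|) / lam) * T <
          liminf (fun n => gridJumps T n X) atTop} := fun X hX => by
      have h := lt_of_lt_of_le hX (flowNorm_empFlow_le X hT0)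
      rw [mul_comm, ← div_eq_mul_inv] at h
      exact (ENNReal.lt_div_iff_mul_lt (Or.inl (by exact_mod_cast hT0.ne'))
        (Or.inl ENNReal.coe_ne_top)).1 h
    refine (measure_mono hsub).trans ((r.law_le_exp hr x
      (T := T) (H := fun ω n => lam * n + σ * r.occupation (fun y => f y) T n ω)
      hGm hG1 (fun ω n h0 h₁ h₂ => ?_)
      (measurableSet_lt measurable_const (.liminf fun n => measurable_gridJumps T n))
      fun ω n hω h₁ h₂ hmem => ?_).trans (htail ℓ hT))
    · rw [← sub_sub]
      exact hG ω n h0 h₁ h₂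
    · have hle : liminf (fun m => gridJumps T m (r.path ω)) atTop ≤ n := by
        refine (liminf_le_liminf (v := fun _ => (n : ℝ≥0∞)) ?_).trans_eq (by simp)
        filter_upwards [eventually_gt_atTop 0] with m hm
        exact Rates.gridJumps_path_le hω.noExplosion h₁ h₂ hm
      have h := lt_of_lt_of_le hmem hle
      rw [← ENNReal.ofReal_coe_nnreal, ← ENNReal.ofReal_mul (by positivity),
        ← ENNReal.ofReal_natCast, ENNReal.ofReal_lt_ofReal_iff_of_nonneg (by positivity),
        div_mul_eq_mul_div, div_lt_iff₀ hlam] at h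
      have := mul_nonneg hσ.le (hocc T n ω)
      linarith

end Tails

end JumpChain

end

theorem mainTheorem6 {V : Type*} [Countable V] [TopologicalSpace V] [DiscreteTopology V]
    [MeasurableSpace V] [BorelSpace V] (r : Rates V)
    (hNonExpl : r.NonExplosive) (hIrr : r.Irreducible)
    (hInv : ∃! π : ProbabilityMeasure V, r.Invariant π)
    (hC : r.CompactnessCondition) (x : V) :
    (∃ (K : ℕ → Set (ProbabilityMeasure V)) (A : ℕ → ℝ),
      (∀ ℓ, IsCompact (K ℓ)) ∧ StrictMono A ∧ Tendsto A atTop atTop ∧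
      ∀ ℓ : ℕ,
        expRate (r.law x) (fun T => {X | empMeasure T X ∉ K ℓ}) ≤ ((-(ℓ : ℝ) : ℝ) : EReal) ∧
        expRate (r.law x) (fun T => {X | ((A ℓ : ℝ) : EReal) < (flowNorm (empFlow T X) : EReal)}) ≤
          ((-(ℓ : ℝ) : ℝ) : EReal)) ∧
    ExpTight (r.law x) (id : ProbabilityMeasure V → ProbabilityMeasure V)
      (fun T X => empMeasure T X) ∧
    ExpTight (r.law x) (Rates.FlowSpace.extend r) (fun T X => empFlow T X) := by
  obtain ⟨f, a, A, hf, hA, hAtop, hApos, htail⟩ := r.exists_exponential_tails hNonExpl hC x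
  set K : ℕ → Set (ProbabilityMeasure V) := fun ℓ =>
    closure {μ | ∫⁻ y, f y ∂(μ : Measure V) ≤ a ℓ} with hK
  have hKc : ∀ ℓ, IsCompact (K ℓ) := fun ℓ => isCompact_closure_lintegral_le hf (a ℓ)
  have hμ : ∀ ℓ : ℕ,
      expRate (r.law x) (fun T => {X | empMeasure T X ∉ K ℓ}) ≤ ((-(ℓ : ℝ) : ℝ) : EReal) := by
    refine fun ℓ => expRate_le_of_eventually ?_
    filter_upwards [(htail ℓ).1, eventually_gt_atTop 0] with T hT hT0
    -- By contraposition: if the integral of `f` along the path is at most `a ℓ * T`, then the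
    -- empirical measure already lies in `K ℓ`.
    refine (measure_mono fun X hX => ?_).trans hT
    by_contra hc
    refine hX (subset_closure ?_)
    change ∫⁻ y, f y ∂(empMeasure T X : Measure V) ≤ a ℓ
    rw [lintegral_empMeasure f hT0, mul_comm, ← div_eq_mul_inv]
    refine ENNReal.div_le_of_le_mul ?_
    rw [← ENNReal.coe_mul]
    exact not_lt.1 hc
  refine ⟨⟨K, A, hKc, hA, hAtop, fun ℓ => ⟨hμ ℓ, expRate_le_of_eventually ?_⟩⟩, fun M => ?_,
    fun M => ?_⟩
  · filter_upwards [(htail ℓ).2] with T hT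
    refine (measure_mono fun X hX => ?_).trans hT
    by_contra hc
    have h : (flowNorm (empFlow T X) : EReal) ≤ (A ℓ : EReal) :=
      (EReal.coe_ennreal_le_coe_ennreal_iff.2 (not_lt.1 hc)).trans_eq (by
        rw [EReal.coe_ennreal_ofReal, max_eq_left (hApos ℓ).le])
    exact absurd hX (not_lt.2 h)
  · obtain ⟨ℓ, hℓ⟩ := exists_nat_ge M
    refine ⟨K ℓ, hKc ℓ, ?_⟩
    rw [image_id]
    exact (hμ ℓ).trans (EReal.coe_le_coe_iff.2 (neg_le_neg hℓ))
  · obtain ⟨ℓ, hℓ⟩ := exists_nat_ge M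
    refine ⟨_, isCompact_range_toFlow r (hApos ℓ), le_trans (expRate_le_of_eventually (m := ℓ) ?_)
      (EReal.coe_le_coe_iff.2 (neg_le_neg hℓ))⟩
    filter_upwards [(htail ℓ).2, eventually_gt_atTop 0] with T hT hT0
    -- A flow can miss the compact set only by having mass above `A ℓ` or by charging a bond outside
    -- `E`, and the latter has probability zero.
    have hsub : {X : PathSpace V | empFlow T X ∉ Rates.FlowSpace.extend r ''
          range (massLe.toFlow r : massLe r.edges (A ℓ) → r.FlowSpace)} ⊆
        {X | ENNReal.ofReal (A ℓ) < flowNorm (empFlow T X)} ∪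
          {X | ∃ e ∉ r.edges, empFlow T X e ≠ 0} := fun X hX => by
      by_contra hc
      simp only [mem_union, mem_ofPred_eq, not_or, not_lt, not_exists, not_and, not_not] at hc
      exact hX (mem_extend_range_toFlow r (hApos ℓ).le hc.1 hc.2)
    refine (measure_mono hsub).trans ((measure_union_le _ _).trans ?_)
    rw [r.law_off_edges hNonExpl x hT0, add_zero]
    exact hT
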